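/- Let $n\ge 3$. For $k\ge 2$ let $X_k=GL_k(\mathbb R)/(O_k(\mathbb R)\cdot\mathbb R^*)$; every $z\in X_k$ has a unique Iwasawa form $z=x\cdot y$ with $x$ unipotent upper triangular with entries $x_{i,j}\in\mathbb R$ ($i<j$) and $y=\mathrm{diag}(y_1\cdots y_{k-1},\,y_1\cdots y_{k-2},\dots,y_1,1)$, $y_j>0$. Put $I_s(z)=(y_1^{k-1}y_2^{k-2}\cdots y_{k-1})^s$. Let $P_{k-1,1}(\mathbb Z)\subset SL_k(\mathbb Z)$ be the subgroup of matrices with last row $(0,\dots,0,1)$, and let $$E_{(k-1,1)}(z,s,1)=\sum_{\gamma\in P_{k-1,1}(\mathbb Z)\backslash SL_k(\mathbb Z)} I_s(\gamma z)\qquad(\mathrm{Re}\, s>1),$$ continued meromorphically to $s\in\mathbb C$. Let $\xi(s)=\pi^{-s/2}\Gamma(s/2)\zeta(s)$ (as a meromorphic function), and for $z=x\cdot y\in X_n$ in Iwasawa form let $\mathfrak m_{n-1}(z)\in X_{n-1}$ be the class of the upper left $(n-1)\times(n-1)$ block of $x\cdot y$. For $k\in\{n-1,n\}$ and every $z\in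 X_k$ the series converges absolutely for $\mathrm{Re}\,s>1$ and has a meromorphic continuation to $\mathbb C$. For every $z\in X_n$ and every $s\in\mathbb C$ such that $s\ne1$ and $ns$ is not a zero of $\xi$, the function $E_{(n-1,1)}(z',\cdot,1)$ is holomorphic at $s$ for all $z'\in X_n$, the value $E_{(n-1,1)}(z,s,1)$ is integrable in $(x_{1,n},\dots,x_{n-1,n})\in(\mathbb Z\backslash\mathbb R)^{n-1}$, and $$\int_{(\mathbb Z\backslash\mathbb R)^{n-1}}E_{(n-1,1)}(z,s,1)\prod_{h=1}^{n-1}dx_{h,n}=2\left(y_1^{n-1}y_2^{n-2}\cdots y_{n-1}\right)^s+\frac{\xi(ns-1)}{\xi(ns)}\left(y_1^{n-1}y_2^{n-2}\cdots y_{n-1}\right)^{\frac{1-s}{n-1}}E_{(n-2,1)}\!\left(\mathfrak m_{n-1}(z),\frac{ns-1}{n-1},1\right).$$ Here the right-hand side is read as a meromorphic function of $s$: it is evaluated factor by factor if $ns\notin\{0,1,2\}$ and $\xi(ns-1)\neq0$ (in particular for $\mathrm{Re}\,s>1$), and by its limit at the remaining values of $s$. -/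

import Mathlib

open Matrix Filter Topology MeasureTheory

noncomputable section

namespace DegenerateEisenstein

/-- The subgroup `O_n(ℝ) · ℝ^*` of `GL_n(ℝ)`. -/
def orthogonalScalar (n : ℕ) : Subgroup (GL (Fin n) ℝ) where
  carrier := {g | ∃ c : ℝ, c ≠ 0 ∧ ∃ k ∈ Matrix.orthogonalGroup (Fin n) ℝ,
    (g : Matrix (Fin n) (Fin n) ℝ) = c • k}
  one_mem' := ⟨1, one_ne_zero, 1, one_mem _, by simp⟩
  mul_mem' := by
    rintro a b ⟨c, hc, k, hk, ha⟩ ⟨d, hd, l, hl, hb⟩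
    refine ⟨c * d, mul_ne_zero hc hd, k * l, mul_mem hk hl, ?_⟩
    rw [Units.val_mul, ha, hb, smul_mul_smul_comm]
  inv_mem' := by
    rintro a ⟨c, hc, k, hk, ha⟩
    refine ⟨c⁻¹, inv_ne_zero hc, star k, Unitary.star_mem hk, ?_⟩
    have h1 : (a : Matrix (Fin n) (Fin n) ℝ) * (c⁻¹ • star k) = 1 := by
      rw [ha, smul_mul_smul_comm, mul_inv_cancel₀ hc, one_smul]
      exact (Matrix.mem_orthogonalGroup_iff (Fin n) ℝ).1 hk
    exact Units.inv_eq_of_mul_eq_one_right h1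

/-- The generalized upper half space `X_n = GL_n(ℝ) / (O_n(ℝ) · ℝ^*)`, on which `GL_n(ℝ)` acts from
the left. -/
abbrev UpperHalf (n : ℕ) : Type := GL (Fin n) ℝ ⧸ orthogonalScalar n

/-- The unipotent upper triangular matrix with entries `x i j` above the diagonal. -/
def unip {n : ℕ} (x : Fin n → Fin n → ℝ) : Matrix (Fin n) (Fin n) ℝ :=
  Matrix.of fun i j => if i = j then 1 else if i < j then x i j else 0

/-- The diagonal entries `y_1 ⋯ y_{n-1}, y_1 ⋯ y_{n-2}, …, y_1, 1`. The coordinates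
`y_1, …, y_{n-1}` are stored as `y 0, …, y (n-2)`, so row `i` (counted from `0`) has the entry
`y_1 ⋯ y_{n-1-i}`. -/
def diagEntry {n : ℕ} (y : Fin (n - 1) → ℝ) (i : Fin n) : ℝ :=
  ∏ k : Fin (n - 1) with k.val + i.val + 1 < n, y k

theorem diagEntry_pos {n : ℕ} {y : Fin (n - 1) → ℝ} (hy : ∀ k, 0 < y k) (i : Fin n) :
    0 < diagEntry y i :=
  Finset.prod_pos fun k _ => hy k

theorem det_unip_mul_diagonal_ne_zero {n : ℕ} (x : Fin n → Fin n → ℝ) {y : Fin (n - 1) → ℝ}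
    (hy : ∀ k, 0 < y k) : (unip x * Matrix.diagonal (diagEntry y)).det ≠ 0 := by
  have h1 : (unip x).det = 1 := by
    rw [Matrix.det_of_isUpperTriangular]
    · simp [unip]
    · intro i j hij
      have hij' : j < i := hij
      simp [unip, hij'.ne', hij'.not_gt]
  rw [Matrix.det_mul, h1, one_mul, Matrix.det_diagonal]
  exact (Finset.prod_pos fun i _ => diagEntry_pos hy i).ne'

/-- The matrix `z = x · y` in Iwasawa form, as an element of `GL_n(ℝ)`. -/
def iwasawa {n : ℕ} (x : Fin n → Fin n → ℝ) (y : Fin (n - 1) → ℝ) (hy : ∀ k, 0 < y k) :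
    GL (Fin n) ℝ :=
  Matrix.GeneralLinearGroup.mkOfDetNeZero (unip x * Matrix.diagonal (diagEntry y))
    (det_unip_mul_diagonal_ne_zero x hy)

open Classical in
/-- The coordinates `y_1, …, y_{n-1}` of a point of `X_n`, read off from its Iwasawa form. (Every
point of `X_n` has a unique Iwasawa form, so the second branch never occurs.) -/
def yCoord {n : ℕ} (z : UpperHalf n) : Fin (n - 1) → ℝ :=
  if h : ∃ y : Fin (n - 1) → ℝ, ∃ hy : ∀ k, 0 < y k, ∃ x : Fin n → Fin n → ℝ,
      (QuotientGroup.mk (iwasawa x y hy) : UpperHalf n) = z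
  then h.choose else 1

/-- The function `I_s(z, P_{n-1,1}) = (Y_n ⋯ Y_2)^{s} · Y_1^{-(n-1)s}`, where `Y_n, …, Y_1` are
the diagonal entries of the Iwasawa form of `z`, from top to bottom. -/
def iFunction {n : ℕ} (s : ℂ) (z : UpperHalf n) : ℂ :=
  ((∏ i : Fin n with i.val + 1 < n, diagEntry (yCoord z) i : ℝ) : ℂ) ^ s *
    ((∏ i : Fin n with i.val + 1 = n, diagEntry (yCoord z) i : ℝ) : ℂ) ^ (-((n : ℂ) - 1) * s)

/-- The group `P_{n-1,1}(ℤ)` of matrices in `SL_n(ℤ)` with last row `(0, …, 0, 1)`. -/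
def parabolicInt (n : ℕ) : Subgroup (Matrix.SpecialLinearGroup (Fin n) ℤ) where
  carrier := {γ | ∀ i : Fin n, i.val + 1 = n → Pi.single i 1 ᵥ* γ.1 = Pi.single i 1}
  one_mem' := by intro i _; simp
  mul_mem' := by
    intro a b ha hb i hi
    rw [Matrix.SpecialLinearGroup.coe_mul, ← Matrix.vecMul_vecMul, ha i hi, hb i hi]
  inv_mem' := by
    intro a ha i hi
    have h : a.1 * (a⁻¹).1 = 1 := by
      rw [← Matrix.SpecialLinearGroup.coe_mul, mul_inv_cancel, Matrix.SpecialLinearGroup.coe_one]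
    calc Pi.single i 1 ᵥ* (a⁻¹).1 = (Pi.single i 1 ᵥ* a.1) ᵥ* (a⁻¹).1 := by rw [ha i hi]
      _ = Pi.single i 1 := by rw [Matrix.vecMul_vecMul, h, Matrix.vecMul_one]

/-- The coset space `P_{n-1,1}(ℤ) \ SL_n(ℤ)`. -/
abbrev CosetSpace (n : ℕ) : Type := Quotient (QuotientGroup.rightRel (parabolicInt n))

/-- The summand `I_s(γ z, P_{n-1,1})` of the Eisenstein series that belongs to a coset; it does not
depend on the representative `γ`. -/
def eisensteinTerm {n : ℕ} (z : UpperHalf n) (s : ℂ) (q : CosetSpace n) : ℂ :=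
  iFunction s ((Matrix.SpecialLinearGroup.mapGL ℝ q.out : GL (Fin n) ℝ) • z)

/-- `F` is the Eisenstein series `s ↦ E_{(n-1,1)}(z, s, 1)`: it is given by the (absolutely
convergent) series over `P_{n-1,1}(ℤ) \ SL_n(ℤ)` for `Re s > 1` and continued meromorphically to all
of `ℂ`. Requiring normal form fixes the values at removable singularities and sets `F = 0` at poles,
so `F` is unique. -/
def IsEisenstein {n : ℕ} (z : UpperHalf n) (F : ℂ → ℂ) : Prop :=
  MeromorphicNFOn F Set.univ ∧ ∀ s : ℂ, 1 < s.re → HasSum (eisensteinTerm z s) (F s)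

open Classical in
/-- The degenerate Eisenstein series `E_{(n-1,1)}(z, s, 1)`. -/
def eisenstein {n : ℕ} (z : UpperHalf n) : ℂ → ℂ :=
  if h : ∃ F : ℂ → ℂ, IsEisenstein z F then h.choose else 0

/-- The standard parabolic subgroup `P_{n-1,1}(ℝ)`, as a condition on `g ∈ GL_n(ℝ)`: the last row
vanishes off the diagonal. -/
def IsParabolic {n : ℕ} (g : GL (Fin n) ℝ) : Prop :=
  ∀ i j : Fin n, i.val + 1 = n → j ≠ i → (g : Matrix (Fin n) (Fin n) ℝ) i j = 0

theorem IsParabolic.det_block_ne_zero {n : ℕ} {g : GL (Fin n) ℝ} (hg : IsParabolic g) :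
    ((g : Matrix (Fin n) (Fin n) ℝ).submatrix (Fin.castLE (Nat.sub_le n 1))
      (Fin.castLE (Nat.sub_le n 1))).det ≠ 0 := by
  cases n with
  | zero => simp
  | succ m =>
    have h0 : (g : Matrix (Fin (m + 1)) (Fin (m + 1)) ℝ).det ≠ 0 :=
      ((Matrix.isUnit_iff_isUnit_det _).1 g.isUnit).ne_zero
    intro h
    apply h0
    rw [Matrix.det_succ_row _ (Fin.last m)]
    refine Finset.sum_eq_zero fun j _ => ?_
    by_cases hj : j = Fin.last m
    · subst hj
      have : ((g : Matrix (Fin (m + 1)) (Fin (m + 1)) ℝ).submatrix (Fin.last m).succAbove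
          (Fin.last m).succAbove).det = 0 := by
        rw [← h]
        simp only [Fin.succAbove_last]
        rfl
      rw [this, mul_zero]
    · rw [hg (Fin.last m) j (by simp) hj]
      simp

/-- The projection `𝔪_{n-1} : P_{n-1,1}(ℝ) → GL_{n-1}(ℝ)` onto the upper left block. -/
def leviBlock {n : ℕ} (g : GL (Fin n) ℝ) (hg : IsParabolic g) : GL (Fin (n - 1)) ℝ :=
  Matrix.GeneralLinearGroup.mkOfDetNeZero
    ((g : Matrix (Fin n) (Fin n) ℝ).submatrix (Fin.castLE (Nat.sub_le n 1))
      (Fin.castLE (Nat.sub_le n 1))) hg.det_block_ne_zero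

theorem isParabolic_iwasawa {n : ℕ} (x : Fin n → Fin n → ℝ) (y : Fin (n - 1) → ℝ)
    (hy : ∀ k, 0 < y k) : IsParabolic (iwasawa x y hy) := by
  intro i j hi hj
  change (unip x * Matrix.diagonal (diagEntry y)) i j = 0
  have h : ¬ i < j := by
    intro h
    have := j.isLt
    have : i.val < j.val := h
    omega
  rw [Matrix.mul_diagonal]
  simp [unip, hj.symm, h]

/-- Replace the last column `x_{1,n}, …, x_{n-1,n}` of `x` by `t`. -/
def setLastCol {n : ℕ} (x : Fin n → Fin n → ℝ) (t : Fin (n - 1) → ℝ) : Fin n → Fin n → ℝ :=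
  fun i j => if h : i.val < n - 1 ∧ j.val = n - 1 then t ⟨i.val, h.1⟩ else x i j

/-- The unit cube, a fundamental domain for `(ℤ \ ℝ)^{n-1}`. -/
def unitCube (n : ℕ) : Set (Fin (n - 1) → ℝ) := Set.univ.pi fun _ => Set.Ioc 0 1

/-- `y_1^{n-1} y_2^{n-2} ⋯ y_{n-1}`. -/
def yProd {n : ℕ} (y : Fin (n - 1) → ℝ) : ℝ := ∏ k : Fin (n - 1), y k ^ (n - 1 - k.val)

/-- The right-hand side of the constant term formula, as a function of `s`, where `w` is the
point `𝔪_{n-1}(z)` of `X_{n-1}`. The completed zeta function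
`ξ(s) = π^{-s/2} Γ(s/2) ζ(s)` is `completedRiemannZeta`. -/
def constantTerm {n : ℕ} (y : Fin (n - 1) → ℝ) (w : UpperHalf (n - 1)) (s : ℂ) : ℂ :=
  2 * (yProd y : ℂ) ^ s +
    completedRiemannZeta (n * s - 1) / completedRiemannZeta (n * s) *
      (yProd y : ℂ) ^ ((1 - s) / ((n : ℂ) - 1)) *
      eisenstein w ((n * s - 1) / ((n : ℂ) - 1))

end DegenerateEisenstein

end

noncomputable section

namespace DegenerateEisenstein

open HurwitzZeta Asymptotics Set Complex

/-! ### Bounds for the one-dimensional theta kernel -/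

/-! Let `g` be the Iwasawa representative of `z`, and let Q(v) = ‖v g‖² for integral row vectors v.
For n ≥ 2 a coset of the parabolic group is the same as a primitive vector, the last row of a
representative. The summand is then det(g)^s Q(v)^(-ns/2). Every nonzero v is a positive multiple of
a unique primitive vector, so E(z,s) = det(g)^s Λ(ns/2) / ξ(ns), where Λ(u) = π^(-u) Γ(u) ∑
Q(v)^(-u) over v ≠ 0 is the completed Epstein zeta function (`IsPosTriangular.hasSum_primVec`,
`eisensteinTerm_mk`).

Λ is the Mellin transform of θ(x) - 1 with θ(x) = ∑ exp(-π Q(v) x). Its continuation needs only that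
θ is 1 up to rapid decay at ∞ and det(g)⁻¹ x^(-n/2) up to rapid decay at 0
(`IsPosTriangular.isThetaKernel`). Poisson summation on the full lattice is avoided: triangularity
lets the last coordinate be summed alone, which gives a shifted one-dimensional theta series, and an
induction on the size finishes.

For the constant term, let t be the last column above the diagonal and A the upper left block. Then
θ is the sum over v in ℤ^(n-1) of exp(-π Q_A(v) x) times the one-dimensional kernel with shift v·t.
Averaging over t replaces this kernel by x^(-1/2) when v ≠ 0 and leaves it alone when v = 0
(`IsColumnFamily.integral_theta`). After the Mellin transform the mean of Λ is 2 ξ(ns) +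
Λ_A((ns-1)/2). Division by ξ(ns) turns the first term into 2 det^s, and the second is the Eisenstein
series of A, because (n-1)s' = ns - 1 for s' = (ns-1)/(n-1). The exchange of integrals is made for
the entire parts Λ₀, where it is legitimate for every u, so the formula is reached directly at every
admissible s and not by continuing an integral. -/

theorem abs_cosKernel_sub_one_le (a : UnitAddCircle) {x : ℝ} (hx : 0 < x) :
    |cosKernel a x - 1| ≤ cosKernel 0 x - 1 := by
  induction a using QuotientAddGroup.induction_on with | H a =>
  have h0 := hasSum_nat_cosKernel₀ 0 hx
  have ha := hasSum_nat_cosKernel₀ a hx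
  rw [QuotientAddGroup.mk_zero] at h0
  change |cosKernel (a : UnitAddCircle) x - 1| ≤ _
  rw [← ha.tsum_eq, ← Real.norm_eq_abs]
  refine tsum_of_norm_bounded h0 fun n => ?_
  rw [norm_mul, norm_mul, Real.norm_of_nonneg (Real.exp_pos _).le]
  gcongr
  · simp
  · rw [mul_zero, zero_mul, Real.cos_zero]
    exact Real.abs_cos_le_one _

theorem evenKernel_eq_rpow_mul_cosKernel (a : UnitAddCircle) {x : ℝ} (hx : 0 < x) :
    evenKernel a x = x ^ (-(1 / 2) : ℝ) * cosKernel a (1 / x) := by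
  rw [evenKernel_functional_equation, Real.rpow_neg hx.le, one_div (x ^ (1 / 2 : ℝ))]

/-- After one-dimensional Poisson summation the shift enters only through cosines in the nonconstant
terms, and these are largest at shift 0. This gives bounds uniform in the shift. -/
theorem abs_evenKernel_sub_le (a : UnitAddCircle) {x : ℝ} (hx : 0 < x) :
    |evenKernel a x - x ^ (-(1 / 2) : ℝ)| ≤ evenKernel 0 x - x ^ (-(1 / 2) : ℝ) := by
  have hp := Real.rpow_pos_of_pos hx (-(1 / 2))
  have h := abs_cosKernel_sub_one_le a (one_div_pos.2 hx)
  rw [evenKernel_eq_rpow_mul_cosKernel a hx, evenKernel_eq_rpow_mul_cosKernel 0 hx]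
  calc |x ^ (-(1 / 2) : ℝ) * cosKernel a (1 / x) - x ^ (-(1 / 2) : ℝ)|
      = x ^ (-(1 / 2) : ℝ) * |cosKernel a (1 / x) - 1| := by
        rw [← abs_of_pos hp, ← abs_mul, abs_of_pos hp]; ring_nf
    _ ≤ x ^ (-(1 / 2) : ℝ) * (cosKernel 0 (1 / x) - 1) := by gcongr
    _ = _ := by ring

theorem evenKernel_le_evenKernel_zero (a : UnitAddCircle) {x : ℝ} (hx : 0 < x) :
    evenKernel a x ≤ evenKernel 0 x := by
  have := (le_abs_self _).trans (abs_evenKernel_sub_le a hx)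
  linarith

theorem evenKernel_nonneg (a : UnitAddCircle) {x : ℝ} (hx : 0 < x) : 0 ≤ evenKernel a x := by
  induction a using QuotientAddGroup.induction_on with | H a =>
  exact (hasSum_int_evenKernel a hx).nonneg fun n => (Real.exp_pos _).le

/-! ### Functions with the asymptotics of a theta function -/

/-- Functions on `(0, ∞)` which are `1` up to rapid decay at `∞` and `c * x ^ (-k)` up to rapid
decay at `0`. -/
structure IsThetaKernel (f : ℝ → ℝ) (k c : ℝ) : Prop where
  continuousOn : ContinuousOn f (Ioi 0)
  isBigO_top (r : ℝ) : (fun x => f x - 1) =O[atTop] (fun x => x ^ r)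
  isBigO_zero (r : ℝ) : (fun x => f x - c * x ^ (-k)) =O[𝓝[>] 0] (fun x => x ^ r)

theorem eventually_pos_nhdsGT_zero : ∀ᶠ x : ℝ in 𝓝[>] 0, 0 < x := self_mem_nhdsWithin

theorem IsThetaKernel.isBigO_zero' {f : ℝ → ℝ} {k c : ℝ} (hf : IsThetaKernel f k c) :
    f =O[𝓝[>] 0] (fun x => x ^ (-k)) := by
  have h := (hf.isBigO_zero (-k)).add
    ((isBigO_refl (fun x : ℝ => x ^ (-k)) (𝓝[>] 0)).const_mul_left c)
  simpa using h

theorem isThetaKernel_one : IsThetaKernel (fun _ => 1) 0 1 where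
  continuousOn := continuousOn_const
  isBigO_top r := by simpa using isBigO_zero _ _
  isBigO_zero r := by simpa using Asymptotics.isBigO_zero _ _

theorem IsThetaKernel.mul {f g : ℝ → ℝ} {k l c d : ℝ} (hf : IsThetaKernel f k c)
    (hg : IsThetaKernel g l d) : IsThetaKernel (fun x => f x * g x) (k + l) (c * d) where
  continuousOn := hf.continuousOn.mul hg.continuousOn
  isBigO_top r := by
    have hg1 : g =O[atTop] (fun _ => (1 : ℝ)) := by
      have h := (hg.isBigO_top 0).add (isBigO_refl (fun _ : ℝ => (1 : ℝ)) atTop |>.congr_right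
        fun x => (Real.rpow_zero x).symm)
      simpa using h
    have h := ((hf.isBigO_top r).mul hg1).add ((hg.isBigO_top r).congr_right
      fun x => (mul_one _).symm)
    refine (h.congr_left fun x => ?_).congr_right fun x => mul_one _
    ring
  isBigO_zero r := by
    -- The error is (f - c x^(-k)) g + c x^(-k) (g - d x^(-l)); the exponents r + l and r + k
    -- compensate for the growth of the other factor.
    have h1 := (hf.isBigO_zero (r + l)).mul hg.isBigO_zero'
    have h2 := ((isBigO_refl (fun x : ℝ => x ^ (-k)) (𝓝[>] 0)).const_mul_left c).mul
      (hg.isBigO_zero (r + k))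
    have h1' := h1.congr' EventuallyEq.rfl (g₂ := fun x => x ^ r) <| by
      filter_upwards [eventually_pos_nhdsGT_zero] with x hx
      rw [← Real.rpow_add hx]; congr 1; ring
    have h2' := h2.congr' EventuallyEq.rfl (g₂ := fun x => x ^ r) <| by
      filter_upwards [eventually_pos_nhdsGT_zero] with x hx
      rw [← Real.rpow_add hx]; congr 1; ring
    refine (h1'.add h2').congr' ?_ EventuallyEq.rfl
    filter_upwards [eventually_pos_nhdsGT_zero] with x hx
    rw [neg_add, Real.rpow_add hx]
    ring

/-- In the application `F` is the kernel with all shifts replaced by 0 and `h` is the common main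
part at 0. Near ∞, `f` is squeezed between 1 and `F`; near 0, `F - h` is small because `F` and `h`
have the same leading term. -/
theorem IsThetaKernel.of_le {f F h : ℝ → ℝ} {k c : ℝ} (hF : IsThetaKernel F k c)
    (hf : ContinuousOn f (Ioi 0)) (h1 : ∀ x, 0 < x → 1 ≤ f x) (h2 : ∀ x, 0 < x → f x ≤ F x)
    (h3 : ∀ x, 0 < x → |f x - h x| ≤ F x - h x)
    (hh : ∀ r : ℝ, (fun x => h x - c * x ^ (-k)) =O[𝓝[>] 0] (fun x => x ^ r)) :
    IsThetaKernel f k c where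
  continuousOn := hf
  isBigO_top r := by
    refine IsBigO.trans (IsBigO.of_bound 1 ?_) (hF.isBigO_top r)
    filter_upwards [eventually_gt_atTop 0] with x hx
    have := h1 x hx
    have := h2 x hx
    rw [one_mul, Real.norm_of_nonneg (by linarith), Real.norm_of_nonneg (by linarith)]
    linarith
  isBigO_zero r := by
    have h4 : (fun x => f x - h x) =O[𝓝[>] 0] (fun x => x ^ r) := by
      refine IsBigO.trans (IsBigO.of_bound 1 ?_) ((hF.isBigO_zero r).sub (hh r))
      filter_upwards [eventually_pos_nhdsGT_zero] with x hx
      rw [one_mul, Real.norm_eq_abs, Real.norm_eq_abs, sub_sub_sub_cancel_right]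
      exact (h3 x hx).trans (le_abs_self _)
    simpa using h4.add (hh r)

theorem isBigO_cosKernel_zero_sub (r : ℝ) :
    (fun x => cosKernel 0 x - 1) =O[atTop] (fun x => x ^ r) := by
  obtain ⟨p, hp, h⟩ := isBigO_atTop_cosKernel_sub 0
  exact h.trans (isLittleO_exp_neg_mul_rpow_atTop hp r).isBigO

theorem isThetaKernel_evenKernel {d : ℝ} (hd : 0 < d) :
    IsThetaKernel (fun x => evenKernel 0 (d * x)) (1 / 2) (d ^ (-(1 / 2) : ℝ)) where
  continuousOn := (continuousOn_evenKernel 0).comp (by fun_prop) fun x hx => mul_pos hd hx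
  isBigO_top r := by
    have h := (isBigO_cosKernel_zero_sub r).comp_tendsto (tendsto_id.const_mul_atTop hd)
    rw [evenKernel_eq_cosKernel_of_zero]
    refine h.trans (IsBigO.of_bound (d ^ r) ?_)
    filter_upwards [eventually_gt_atTop 0] with x hx
    simp [Real.mul_rpow hd.le hx.le, abs_of_pos (Real.rpow_pos_of_pos hd r)]
  isBigO_zero r := by
    have ht : Tendsto (fun x : ℝ => 1 / (d * x)) (𝓝[>] 0) atTop := by
      have := (tendsto_inv_nhdsGT_zero (𝕜 := ℝ)).const_mul_atTop (inv_pos.2 hd)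
      refine this.congr fun x => ?_
      rw [one_div, mul_inv]
    have h := (isBigO_cosKernel_zero_sub (-(r + 1 / 2))).comp_tendsto ht
    have h2 := (isBigO_refl (fun x : ℝ => (d * x) ^ (-(1 / 2) : ℝ)) (𝓝[>] 0)).mul h
    refine IsBigO.trans (h2.congr' ?_ EventuallyEq.rfl) (IsBigO.of_bound (d ^ r) ?_)
    · filter_upwards [eventually_pos_nhdsGT_zero] with x hx
      rw [evenKernel_eq_rpow_mul_cosKernel 0 (mul_pos hd hx), ← Real.mul_rpow hd.le hx.le]
      simp only [Function.comp]
      ring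
    · filter_upwards [eventually_pos_nhdsGT_zero] with x hx
      have hdx := mul_pos hd hx
      rw [Function.comp, one_div (d * x), Real.inv_rpow hdx.le, ← Real.rpow_neg hdx.le,
        ← Real.rpow_add hdx, ← Real.norm_of_nonneg (Real.rpow_pos_of_pos hd r).le, ← norm_mul,
        ← Real.mul_rpow hd.le hx.le]
      apply le_of_eq
      congr 2
      ring

theorem tendsto_one_div_atTop_nhdsGT_zero : Tendsto (fun x : ℝ => 1 / x) atTop (𝓝[>] 0) := by
  simpa using tendsto_inv_atTop_nhdsGT_zero (𝕜 := ℝ)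

/-- The pair of functions related by a functional equation that belongs to a theta kernel. -/
def IsThetaKernel.pair {f : ℝ → ℝ} {k c : ℝ} (hf : IsThetaKernel f k c) (hk : 0 < k) :
    WeakFEPair ℂ where
  f x := f x
  -- The partner is defined by inversion, so the functional equation is a tautology; the content
  -- lies in the decay of `f` at 0, which becomes decay of `g` at ∞.
  g x := ((x ^ (-k) * f (1 / x) : ℝ) : ℂ)
  k := k
  ε := 1
  f₀ := 1
  g₀ := c
  hf_int := (continuous_ofReal.comp_continuousOn hf.continuousOn).locallyIntegrableOn
    measurableSet_Ioi
  hg_int := by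
    refine (continuous_ofReal.comp_continuousOn
      (ContinuousOn.mul ?_ (hf.continuousOn.comp ?_ ?_))).locallyIntegrableOn measurableSet_Ioi
    · exact fun x hx => (Real.continuousAt_rpow_const _ _ (Or.inl (ne_of_gt hx))).continuousWithinAt
    · exact fun x hx => (continuousAt_const.div continuousAt_id (ne_of_gt hx)).continuousWithinAt
    · exact fun x hx => mem_Ioi.2 (one_div_pos.2 hx)
  hk := hk
  hε := one_ne_zero
  h_feq x hx := by
    have hx : 0 < x := hx
    rw [one_mul, smul_eq_mul, ← ofReal_mul, ← mul_assoc, ← Real.rpow_add hx]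
    simp
  hf_top r := by
    refine IsBigO.trans (IsBigO.of_bound 1 (Eventually.of_forall fun x => ?_)) (hf.isBigO_top r)
    rw [one_mul, ← ofReal_one, ← ofReal_sub, norm_real]
  hg_top r := by
    have h := (isBigO_refl (fun x : ℝ => x ^ (-k)) atTop).mul
      ((hf.isBigO_zero (-(r + k))).comp_tendsto tendsto_one_div_atTop_nhdsGT_zero)
    refine (IsBigO.trans (IsBigO.of_bound 1 ?_) h).congr' EventuallyEq.rfl ?_
    · filter_upwards [eventually_gt_atTop 0] with x hx
      rw [← ofReal_sub, norm_real, one_mul, Function.comp, mul_sub]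
      apply le_of_eq
      congr 2
      rw [one_div x, Real.inv_rpow hx.le, ← Real.rpow_neg hx.le, mul_left_comm,
        ← Real.rpow_add hx]
      simp
    · filter_upwards [eventually_gt_atTop 0] with x hx
      rw [Function.comp, one_div x, Real.inv_rpow hx.le, ← Real.rpow_neg hx.le,
        ← Real.rpow_add hx]
      congr 1
      ring

/-! ### Theta functions of triangular matrices -/

/-- The quadratic form `v ↦ ‖v g‖²` on row vectors with integer entries. -/
def rowQ {n : ℕ} (g : Matrix (Fin n) (Fin n) ℝ) (v : Fin n → ℤ) : ℝ :=
  ∑ j, ((fun i => (v i : ℝ)) ᵥ* g) j ^ 2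

/-- The theta function of the quadratic form `rowQ g`. -/
def theta {n : ℕ} (g : Matrix (Fin n) (Fin n) ℝ) (x : ℝ) : ℝ :=
  ∑' v : Fin n → ℤ, Real.exp (-Real.pi * rowQ g v * x)

/-- Upper triangular matrices with positive diagonal. -/
structure IsPosTriangular {n : ℕ} (g : Matrix (Fin n) (Fin n) ℝ) : Prop where
  eq_zero : ∀ i j, j < i → g i j = 0
  pos : ∀ i, 0 < g i i

/-- The upper left block of a square matrix. -/
def topBlock {n : ℕ} (g : Matrix (Fin (n + 1)) (Fin (n + 1)) ℝ) : Matrix (Fin n) (Fin n) ℝ :=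
  g.submatrix Fin.castSucc Fin.castSucc

theorem IsPosTriangular.topBlock {n : ℕ} {g : Matrix (Fin (n + 1)) (Fin (n + 1)) ℝ}
    (hg : IsPosTriangular g) : IsPosTriangular (topBlock g) where
  eq_zero _ _ hij := hg.eq_zero _ _ (Fin.castSucc_lt_castSucc_iff.2 hij)
  pos _ := hg.pos _

/-- The last entry of `(v, 0) g`, divided by the last diagonal entry of `g`. -/
def lastShift {n : ℕ} (g : Matrix (Fin (n + 1)) (Fin (n + 1)) ℝ) (v : Fin n → ℤ) : ℝ :=
  (∑ i, v i * g i.castSucc (Fin.last n)) / g (Fin.last n) (Fin.last n)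

theorem rowQ_nonneg {n : ℕ} (g : Matrix (Fin n) (Fin n) ℝ) (v : Fin n → ℤ) : 0 ≤ rowQ g v :=
  Finset.sum_nonneg fun _ _ => sq_nonneg _

theorem rowQ_zero {n : ℕ} (g : Matrix (Fin n) (Fin n) ℝ) : rowQ g 0 = 0 := by
  simp [rowQ, Matrix.vecMul, dotProduct]

/-- The last row of a triangular matrix vanishes off the diagonal, so the last coordinate of the
vector affects only the last coordinate of the image. Completing it to k + shift prepares the sum
over k. -/
theorem rowQ_snoc {n : ℕ} {g : Matrix (Fin (n + 1)) (Fin (n + 1)) ℝ} (hg : IsPosTriangular g)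
    (k : ℤ) (v : Fin n → ℤ) :
    rowQ g (Fin.snocEquiv (fun _ => ℤ) (k, v)) = rowQ (topBlock g) v +
      g (Fin.last n) (Fin.last n) ^ 2 * (k + lastShift g v) ^ 2 := by
  have h1 (j : Fin n) : ((fun i => ((Fin.snocEquiv (fun _ => ℤ) (k, v) i : ℤ) : ℝ)) ᵥ* g)
      j.castSucc = ((fun i => (v i : ℝ)) ᵥ* topBlock g) j := by
    simp [Matrix.vecMul, dotProduct, Fin.sum_univ_castSucc, Fin.snocEquiv, topBlock,
      hg.eq_zero (Fin.last n) j.castSucc (Fin.castSucc_lt_last j)]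
  have h2 : ((fun i => ((Fin.snocEquiv (fun _ => ℤ) (k, v) i : ℤ) : ℝ)) ᵥ* g) (Fin.last n) =
      g (Fin.last n) (Fin.last n) * (k + lastShift g v) := by
    have := (hg.pos (Fin.last n)).ne'
    simp only [Matrix.vecMul, dotProduct, Fin.sum_univ_castSucc, Fin.snocEquiv, lastShift,
      Equiv.coe_fn_mk, Fin.snoc_castSucc, Fin.snoc_last]
    field_simp
    ring
  rw [rowQ, Fin.sum_univ_castSucc, h2, mul_pow]
  simp only [h1, rowQ]

theorem rowQ_pos {n : ℕ} {g : Matrix (Fin n) (Fin n) ℝ} (hg : g.det ≠ 0)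
    {v : Fin n → ℤ} (hv : v ≠ 0) : 0 < rowQ g v := by
  refine lt_of_le_of_ne (rowQ_nonneg g v) fun h => hv ?_
  have h0 : (fun i => (v i : ℝ)) ᵥ* g = 0 := by
    ext j
    have := (Finset.sum_eq_zero_iff_of_nonneg (fun _ _ => sq_nonneg _)).1 h.symm j
      (Finset.mem_univ j)
    simpa using this
  have h1 := Matrix.eq_zero_of_vecMul_eq_zero hg h0
  ext i
  simpa using congrFun h1 i

theorem IsPosTriangular.det_eq {n : ℕ} {g : Matrix (Fin n) (Fin n) ℝ} (hg : IsPosTriangular g) :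
    g.det = ∏ i, g i i :=
  Matrix.det_of_isUpperTriangular fun i j hij => hg.eq_zero i j hij

theorem IsPosTriangular.det_pos {n : ℕ} {g : Matrix (Fin n) (Fin n) ℝ} (hg : IsPosTriangular g) :
    0 < g.det := by
  rw [hg.det_eq]
  exact Finset.prod_pos fun i _ => hg.pos i

theorem IsPosTriangular.det_eq_mul {n : ℕ} {g : Matrix (Fin (n + 1)) (Fin (n + 1)) ℝ}
    (hg : IsPosTriangular g) :
    g.det = (DegenerateEisenstein.topBlock g).det * g (Fin.last n) (Fin.last n) := by
  rw [hg.det_eq, hg.topBlock.det_eq, Fin.prod_univ_castSucc]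
  rfl

theorem IsPosTriangular.hasSum_inner {n : ℕ} {g : Matrix (Fin (n + 1)) (Fin (n + 1)) ℝ}
    (hg : IsPosTriangular g) (v : Fin n → ℤ) {x : ℝ} (hx : 0 < x) :
    HasSum (fun k : ℤ => Real.exp (-Real.pi * rowQ g (Fin.snocEquiv (fun _ => ℤ) (k, v)) * x))
      (Real.exp (-Real.pi * rowQ (DegenerateEisenstein.topBlock g) v * x) *
        evenKernel (lastShift g v : ℝ) (g (Fin.last n) (Fin.last n) ^ 2 * x)) := by
  refine ((hasSum_int_evenKernel (lastShift g v)
    (mul_pos (pow_pos (hg.pos (Fin.last n)) 2) hx)).mul_left _).congr_fun fun k => ?_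
  rw [rowQ_snoc hg, ← Real.exp_add]
  congr 1
  ring

theorem IsPosTriangular.summable_exp {n : ℕ} {g : Matrix (Fin n) (Fin n) ℝ}
    (hg : IsPosTriangular g) {x : ℝ} (hx : 0 < x) :
    Summable fun v : Fin n → ℤ => Real.exp (-Real.pi * rowQ g v * x) := by
  induction n with
  | zero => exact Summable.of_finite
  | succ n ih =>
    rw [← (Fin.snocEquiv (fun _ : Fin (n + 1) => ℤ)).summable_iff,
      ← (Equiv.prodComm _ _).summable_iff]
    refine (summable_prod_of_nonneg fun _ => (Real.exp_pos _).le).2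
      ⟨fun v => (hg.hasSum_inner v hx).summable, ?_⟩
    have hd := mul_pos (pow_pos (hg.pos (Fin.last n)) 2) hx
    refine Summable.of_nonneg_of_le (fun v => tsum_nonneg fun _ => (Real.exp_pos _).le) (fun v => ?_)
      ((ih hg.topBlock).mul_right (evenKernel 0 (g (Fin.last n) (Fin.last n) ^ 2 * x)))
    refine ((hg.hasSum_inner v hx).tsum_eq).le.trans ?_
    gcongr
    exact evenKernel_le_evenKernel_zero _ hd

theorem IsPosTriangular.hasSum_theta {n : ℕ} {g : Matrix (Fin n) (Fin n) ℝ}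
    (hg : IsPosTriangular g) {x : ℝ} (hx : 0 < x) :
    HasSum (fun v : Fin n → ℤ => Real.exp (-Real.pi * rowQ g v * x)) (theta g x) :=
  (hg.summable_exp hx).hasSum

theorem IsPosTriangular.hasSum_theta_succ {n : ℕ} {g : Matrix (Fin (n + 1)) (Fin (n + 1)) ℝ}
    (hg : IsPosTriangular g) {x : ℝ} (hx : 0 < x) :
    HasSum (fun v : Fin n → ℤ =>
      Real.exp (-Real.pi * rowQ (DegenerateEisenstein.topBlock g) v * x) *
        evenKernel (lastShift g v : ℝ) (g (Fin.last n) (Fin.last n) ^ 2 * x)) (theta g x) := by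
  have h := hg.hasSum_theta hx
  rw [← (Fin.snocEquiv (fun _ : Fin (n + 1) => ℤ)).hasSum_iff,
      ← (Equiv.prodComm _ _).hasSum_iff] at h
  exact h.prod_fiberwise fun v => hg.hasSum_inner v hx

theorem IsPosTriangular.one_le_theta {n : ℕ} {g : Matrix (Fin n) (Fin n) ℝ}
    (hg : IsPosTriangular g) {x : ℝ} (hx : 0 < x) : 1 ≤ theta g x := by
  have := (hg.summable_exp hx).le_tsum 0 fun _ _ => (Real.exp_pos _).le
  simpa [rowQ_zero, theta] using this

theorem IsPosTriangular.continuousOn_theta {n : ℕ} {g : Matrix (Fin n) (Fin n) ℝ}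
    (hg : IsPosTriangular g) : ContinuousOn (theta g) (Ioi 0) := by
  intro x hx
  have hx : 0 < x := hx
  have h : ContinuousOn (theta g) (Ici (x / 2)) := by
    refine continuousOn_tsum (fun v => by fun_prop) (hg.summable_exp (half_pos hx))
      fun v y hy => ?_
    rw [Real.norm_of_nonneg (Real.exp_pos _).le]
    apply Real.exp_le_exp.2
    have := mul_nonneg Real.pi_pos.le (rowQ_nonneg g v)
    nlinarith [mem_Ici.1 hy]
  exact (h.continuousAt (Ici_mem_nhds (half_lt_self hx))).continuousWithinAt

theorem IsPosTriangular.theta_le {n : ℕ} {g : Matrix (Fin (n + 1)) (Fin (n + 1)) ℝ}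
    (hg : IsPosTriangular g) {x : ℝ} (hx : 0 < x) :
    theta g x ≤ theta (DegenerateEisenstein.topBlock g) x *
      evenKernel 0 (g (Fin.last n) (Fin.last n) ^ 2 * x) := by
  refine hasSum_le (fun v => ?_) (hg.hasSum_theta_succ hx) ((hg.topBlock.hasSum_theta hx).mul_right _)
  gcongr
  exact evenKernel_le_evenKernel_zero _ (mul_pos (pow_pos (hg.pos (Fin.last n)) 2) hx)

theorem IsPosTriangular.abs_theta_sub_le {n : ℕ} {g : Matrix (Fin (n + 1)) (Fin (n + 1)) ℝ}
    (hg : IsPosTriangular g) {x : ℝ} (hx : 0 < x) :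
    |theta g x - theta (DegenerateEisenstein.topBlock g) x *
        (g (Fin.last n) (Fin.last n) ^ 2 * x) ^ (-(1 / 2) : ℝ)| ≤
      theta (DegenerateEisenstein.topBlock g) x *
          evenKernel 0 (g (Fin.last n) (Fin.last n) ^ 2 * x) -
        theta (DegenerateEisenstein.topBlock g) x *
          (g (Fin.last n) (Fin.last n) ^ 2 * x) ^ (-(1 / 2) : ℝ) := by
  have hd := mul_pos (pow_pos (hg.pos (Fin.last n)) 2) hx
  have ht := hg.topBlock.hasSum_theta hx
  have h1 := (hg.hasSum_theta_succ hx).sub (ht.mul_right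
    ((g (Fin.last n) (Fin.last n) ^ 2 * x) ^ (-(1 / 2) : ℝ)))
  have h2 := ht.mul_right (evenKernel 0 (g (Fin.last n) (Fin.last n) ^ 2 * x) -
    (g (Fin.last n) (Fin.last n) ^ 2 * x) ^ (-(1 / 2) : ℝ))
  rw [← mul_sub, ← h1.tsum_eq, ← Real.norm_eq_abs]
  refine tsum_of_norm_bounded h2 fun v => ?_
  rw [← mul_sub, norm_mul, Real.norm_of_nonneg (Real.exp_pos _).le]
  gcongr
  exact abs_evenKernel_sub_le _ hd

/-- Induction on the size, comparing with the product of the theta function of the upper left block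
and the unshifted one-dimensional kernel. The factor d⁻¹ gained at 0 is what turns the determinant
of the block into that of `g`. -/
theorem IsPosTriangular.isThetaKernel {n : ℕ} {g : Matrix (Fin n) (Fin n) ℝ}
    (hg : IsPosTriangular g) : IsThetaKernel (theta g) (n / 2) g.det⁻¹ := by
  induction n with
  | zero =>
    have h : theta g = fun _ => 1 := by
      ext x
      simp [theta, rowQ]
    simpa [h] using isThetaKernel_one
  | succ n ih =>
    set d := g (Fin.last n) (Fin.last n)
    have hd : 0 < d := hg.pos _
    have hd' : (d ^ 2) ^ (-(1 / 2) : ℝ) = d⁻¹ := by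
      rw [← Real.rpow_natCast, ← Real.rpow_mul hd.le, ← Real.rpow_neg_one]
      norm_num
    have hF := (ih hg.topBlock).mul (isThetaKernel_evenKernel (pow_pos hd 2))
    rw [hd', ← mul_inv, ← hg.det_eq_mul,
      show (n / 2 + 1 / 2 : ℝ) = ((n + 1 : ℕ) : ℝ) / 2 by push_cast; ring] at hF
    refine hF.of_le hg.continuousOn_theta (fun x hx => hg.one_le_theta hx)
      (fun x hx => hg.theta_le hx) (fun x hx => hg.abs_theta_sub_le hx) fun r => ?_
    have h := ((ih hg.topBlock).isBigO_zero (r + 1 / 2)).mul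
      ((isBigO_refl (fun x : ℝ => x ^ (-(1 / 2) : ℝ)) (𝓝[>] 0)).const_mul_left d⁻¹)
    refine h.congr' ?_ ?_
    · filter_upwards [eventually_pos_nhdsGT_zero] with x hx
      rw [Real.mul_rpow (by positivity) hx.le, hd', hg.det_eq_mul, mul_inv,
        show (-(((n + 1 : ℕ) : ℝ) / 2)) = -(n / 2) + -(1 / 2) by push_cast; ring,
        Real.rpow_add hx]
      ring
    · filter_upwards [eventually_pos_nhdsGT_zero] with x hx
      rw [← Real.rpow_add hx]
      congr 1
      ring

/-! ### The Epstein zeta function as a Mellin transform -/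

/-- The functional equation pair of the theta function of a triangular matrix. -/
def IsPosTriangular.pair {n : ℕ} {g : Matrix (Fin n) (Fin n) ℝ} (hg : IsPosTriangular g)
    (hn : 0 < n) : WeakFEPair ℂ :=
  hg.isThetaKernel.pair (by positivity)

theorem IsPosTriangular.hasSum_theta_sub_one {n : ℕ} {g : Matrix (Fin n) (Fin n) ℝ}
    (hg : IsPosTriangular g) {x : ℝ} (hx : 0 < x) :
    HasSum (fun v : {v : Fin n → ℤ // v ≠ 0} => Real.exp (-Real.pi * rowQ g v * x))
      (theta g x - 1) := by
  classical
  have h := hasSum_ite_sub_hasSum (hg.hasSum_theta hx) 0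
  rw [rowQ_zero, mul_zero, zero_mul, Real.exp_zero] at h
  rw [← hasSum_subtype_iff_of_support_subset (s := {v : Fin n → ℤ | v ≠ 0})
    fun v hv h0 => hv (if_pos h0)] at h
  exact h.congr_fun fun v => (if_neg v.2).symm

/-- All terms are positive, so every finite partial sum, written as a Mellin integral, is bounded by
the convergent Mellin integral of the full theta function minus 1. -/
theorem IsPosTriangular.summable_rowQ {n : ℕ} {g : Matrix (Fin n) (Fin n) ℝ}
    (hg : IsPosTriangular g) (hn : 0 < n) {σ : ℝ} (hσ : n / 2 < σ) :
    Summable fun v : {v : Fin n → ℤ // v ≠ 0} => 1 / rowQ g v ^ σ := by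
  have hσ0 : 0 < σ := lt_trans (by positivity) hσ
  have hq (v : {v : Fin n → ℤ // v ≠ 0}) : 0 < Real.pi * rowQ g v :=
    mul_pos Real.pi_pos (rowQ_pos hg.det_pos.ne' v.2)
  have hconv : IntegrableOn (fun t : ℝ => t ^ (σ - 1) * (theta g t - 1)) (Ioi 0) := by
    have h := ((hg.pair hn).hasMellin (s := σ) hσ).1.norm
    refine IntegrableOn.congr_fun h (fun t ht => ?_) measurableSet_Ioi
    have ht : 0 < t := ht
    have h1 := hg.one_le_theta ht
    change ‖(t : ℂ) ^ ((σ : ℂ) - 1) • (((theta g t : ℝ) : ℂ) - 1)‖ = _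
    rw [norm_smul, norm_cpow_eq_rpow_re_of_pos ht, ← ofReal_one, ← ofReal_sub, ← ofReal_sub,
      ofReal_re, norm_real, Real.norm_of_nonneg (by linarith)]
  have hint (v : {v : Fin n → ℤ // v ≠ 0}) :
      IntegrableOn (fun t : ℝ => t ^ (σ - 1) * Real.exp (-Real.pi * rowQ g v * t)) (Ioi 0) := by
    refine hconv.mono' ?_ ?_
    · refine ContinuousOn.aestronglyMeasurable (fun t ht => ?_) measurableSet_Ioi
      exact ((Real.continuousAt_rpow_const _ _ (Or.inl (ne_of_gt ht))).mul
        (by fun_prop)).continuousWithinAt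
    · refine (ae_restrict_mem measurableSet_Ioi).mono fun t ht => ?_
      have ht : 0 < t := ht
      have hp := Real.rpow_pos_of_pos ht (σ - 1)
      rw [Real.norm_of_nonneg (by positivity)]
      gcongr
      exact le_hasSum (hg.hasSum_theta_sub_one ht) v fun _ _ => (Real.exp_pos _).le
  have hval (v : {v : Fin n → ℤ // v ≠ 0}) :
      ∫ t in Ioi (0 : ℝ), t ^ (σ - 1) * Real.exp (-Real.pi * rowQ g v * t) =
        (Real.Gamma σ / Real.pi ^ σ) * (1 / rowQ g v ^ σ) := by
    have h := Real.integral_rpow_mul_exp_neg_mul_Ioi hσ0 (hq v)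
    simp only [neg_mul] at h ⊢
    rw [h, one_div, Real.inv_rpow (hq v).le, Real.mul_rpow Real.pi_pos.le (rowQ_nonneg g v)]
    field_simp
  have hc : 0 < Real.Gamma σ / Real.pi ^ σ :=
    div_pos (Real.Gamma_pos_of_pos hσ0) (Real.rpow_pos_of_pos Real.pi_pos _)
  refine (summable_mul_left_iff hc.ne').1 ?_
  refine summable_of_sum_le (c := ∫ t in Ioi (0 : ℝ), t ^ (σ - 1) * (theta g t - 1))
    (fun v => mul_nonneg hc.le (one_div_nonneg.2 (Real.rpow_nonneg (rowQ_nonneg g v) _)))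
    fun S => ?_
  simp_rw [← hval]
  rw [← integral_finsetSum S fun v _ => hint v]
  refine setIntegral_mono_on (integrable_finsetSum S fun v _ => hint v) hconv measurableSet_Ioi
    fun t ht => ?_
  have ht : 0 < t := ht
  have hp := Real.rpow_pos_of_pos ht (σ - 1)
  rw [← Finset.mul_sum]
  gcongr
  exact sum_le_hasSum S (fun _ _ => (Real.exp_pos _).le) (hg.hasSum_theta_sub_one ht)

theorem IsPosTriangular.hasSum_rowQ {n : ℕ} {g : Matrix (Fin n) (Fin n) ℝ}
    (hg : IsPosTriangular g) (hn : 0 < n) {u : ℂ} (hu : n / 2 < u.re) :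
    HasSum (fun v : {v : Fin n → ℤ // v ≠ 0} =>
      Real.pi ^ (-u) * Gamma u * 1 / (rowQ g v : ℂ) ^ u) ((hg.pair hn).Λ u) := by
  rw [← ((hg.pair hn).hasMellin (s := u) hu).2]
  refine hasSum_mellin_pi_mul (fun v => Or.inr (rowQ_pos hg.det_pos.ne' v.2))
    (lt_trans (by positivity) hu) (fun t ht => ?_) ?_
  · have h := hasSum_ofReal.2 (hg.hasSum_theta_sub_one ht)
    rw [ofReal_sub, ofReal_one] at h
    exact h.congr_fun fun v => one_mul _
  · simpa using hg.summable_rowQ hn hu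

/-! ### Primitive vectors -/

/-- Primitive integral row vectors. -/
abbrev PrimVec (n : ℕ) : Type := {v : Fin n → ℤ // Finset.univ.gcd v = 1}

/-- Every nonzero integral vector is a positive multiple of a primitive one, in a unique way. -/
def primVecEquiv (n : ℕ) : ℕ × PrimVec n ≃ {v : Fin n → ℤ // v ≠ 0} :=
  Equiv.ofBijective
    -- The index m in ℕ stands for the multiplier m + 1.
    (fun p => ⟨fun i => ((p.1 : ℤ) + 1) * p.2.1 i, by
      intro h
      have h2 : p.2.1 = 0 := by
        ext i
        have := congrFun h i
        have h3 : ((p.1 : ℤ) + 1) ≠ 0 := by positivity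
        simpa [h3] using this
      have := p.2.2
      rw [h2] at this
      have h4 : Finset.univ.gcd (0 : Fin n → ℤ) = 0 := Finset.gcd_eq_zero_iff.2 fun _ _ => rfl
      rw [h4] at this
      exact zero_ne_one this⟩) <| by
    constructor
    · rintro ⟨a, p, hp⟩ ⟨b, q, hq⟩ h
      have h := congrArg Subtype.val h
      simp only at h
      have ha := congrArg Finset.univ.gcd h
      rw [Finset.gcd_mul_left, Finset.gcd_mul_left, hp, hq, mul_one, mul_one,
        Int.normalize_of_nonneg (by positivity), Int.normalize_of_nonneg (by positivity)] at ha
      obtain rfl : a = b := by omega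
      have : p = q := by
        ext i
        exact mul_left_cancel₀ (by positivity : ((a : ℤ) + 1) ≠ 0) (congrFun h i)
      subst this
      rfl
    · rintro ⟨v, hv⟩
      have hne : (Finset.univ : Finset (Fin n)).Nonempty := by
        by_contra h
        rw [Finset.not_nonempty_iff_eq_empty] at h
        refine hv (funext fun i => ?_)
        exact absurd (h ▸ Finset.mem_univ i) (Finset.notMem_empty i)
      obtain ⟨p, hp, hp1⟩ := Finset.extract_gcd v hne
      have h0 : Finset.univ.gcd v ≠ 0 := fun h => hv <| funext fun i =>
        Finset.gcd_eq_zero_iff.1 h i (Finset.mem_univ i)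
      have h1 : 0 ≤ Finset.univ.gcd v := Int.nonneg_of_normalize_eq_self Finset.normalize_gcd
      refine ⟨⟨(Finset.univ.gcd v).toNat - 1, p, hp1⟩, Subtype.ext (funext fun i => ?_)⟩
      have : (((Finset.univ.gcd v).toNat - 1 : ℕ) : ℤ) + 1 = Finset.univ.gcd v := by omega
      simp only [this]
      exact (hp i (Finset.mem_univ i)).symm

theorem rowQ_primVecEquiv {n : ℕ} (g : Matrix (Fin n) (Fin n) ℝ) (m : ℕ) (p : PrimVec n) :
    rowQ g (primVecEquiv n (m, p)) = ((m : ℝ) + 1) ^ 2 * rowQ g p.1 := by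
  simp only [rowQ, Finset.mul_sum, ← mul_pow]
  refine Finset.sum_congr rfl fun j _ => ?_
  congr 1
  simp only [Matrix.vecMul, dotProduct, Finset.mul_sum]
  refine Finset.sum_congr rfl fun i _ => ?_
  change ((((m : ℤ) + 1) * p.1 i : ℤ) : ℝ) * g i j = _
  push_cast
  ring

/-- The form is homogeneous of degree 2, so the sum over nonzero vectors factors as ζ(2u) times the
sum over primitive ones, and π^(-u) Γ(u) ζ(2u) is ξ(2u). -/
theorem IsPosTriangular.hasSum_primVec {n : ℕ} {g : Matrix (Fin n) (Fin n) ℝ}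
    (hg : IsPosTriangular g) (hn : 0 < n) {u : ℂ} (hu : n / 2 < u.re) (hu' : 1 / 2 < u.re) :
    HasSum (fun p : PrimVec n => 1 / (rowQ g p.1 : ℂ) ^ u)
      ((hg.pair hn).Λ u / completedRiemannZeta (2 * u)) := by
  have h2u : 1 < (2 * u).re := by
    simp only [mul_re, re_ofNat, im_ofNat, zero_mul, sub_zero]
    linarith
  have hu0 : 0 < u.re := by linarith
  have hsum : Summable fun v : {v : Fin n → ℤ // v ≠ 0} => 1 / (rowQ g v : ℂ) ^ u := by
    refine Summable.of_norm ?_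
    refine (hg.summable_rowQ hn hu).congr fun v => ?_
    rw [norm_div, norm_one, norm_cpow_eq_rpow_re_of_pos (rowQ_pos hg.det_pos.ne' v.2)]
  have hterm (m : ℕ) (p : PrimVec n) : 1 / (rowQ g (primVecEquiv n (m, p)) : ℂ) ^ u =
      (1 / ((m : ℂ) + 1) ^ (2 * u)) * (1 / (rowQ g p.1 : ℂ) ^ u) := by
    rw [rowQ_primVecEquiv, ofReal_mul, mul_cpow_ofReal_nonneg (by positivity) (rowQ_nonneg _ _)]
    have : ((((m : ℝ) + 1) ^ 2 : ℝ) : ℂ) ^ u = ((m : ℂ) + 1) ^ (2 * u) := by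
      push_cast
      rw [← Nat.cast_add_one, sq, natCast_mul_natCast_cpow,
        ← cpow_add _ _ (Nat.cast_ne_zero.2 m.succ_ne_zero), two_mul]
    rw [this]
    field_simp
  rw [← (primVecEquiv n).summable_iff] at hsum
  have hp : Summable fun p : PrimVec n => 1 / (rowQ g p.1 : ℂ) ^ u := by
    have := hsum.comp_injective (i := fun p : PrimVec n => ((0 : ℕ), p))
      (fun _ _ h => (Prod.mk.inj h).2)
    refine this.congr fun p => ?_
    simp only [Function.comp]
    rw [hterm]
    simp
  have hz := completedZeta_eq_tsum_of_one_lt_re h2u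
  rw [← zeta_eq_tsum_one_div_nat_cpow h2u, neg_div, mul_div_cancel_left₀ _ two_ne_zero] at hz
  have hz0 : completedRiemannZeta (2 * u) ≠ 0 := by
    rw [hz]
    refine mul_ne_zero (mul_ne_zero ?_ (Gamma_ne_zero_of_re_pos hu0))
      (riemannZeta_ne_zero_of_one_lt_re h2u)
    simp [cpow_eq_zero_iff, Real.pi_ne_zero]
  have hsum' : Summable fun m : ℕ => 1 / ((m : ℂ) + 1) ^ (2 * u) := by
    have := (summable_nat_add_iff 1).2 (summable_one_div_nat_cpow.2 h2u)
    simpa using this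
  have hprod : HasSum (fun x : ℕ × PrimVec n => (1 / ((x.1 : ℂ) + 1) ^ (2 * u)) *
      (1 / (rowQ g x.2.1 : ℂ) ^ u))
      (riemannZeta (2 * u) * ∑' p : PrimVec n, 1 / (rowQ g p.1 : ℂ) ^ u) := by
    have hs2 : Summable fun x : ℕ × PrimVec n => (1 / ((x.1 : ℂ) + 1) ^ (2 * u)) *
        (1 / (rowQ g x.2.1 : ℂ) ^ u) := hsum.congr fun x => hterm x.1 x.2
    rw [zeta_eq_tsum_one_div_nat_add_one_cpow h2u, hsum'.tsum_mul_tsum hp hs2]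
    exact hs2.hasSum
  have hall := hg.hasSum_rowQ hn hu
  rw [← (primVecEquiv n).hasSum_iff] at hall
  have hall' := (hprod.mul_left (Real.pi ^ (-u) * Gamma u)).unique
    (hall.congr_fun fun x => by
      simp only [Function.comp]
      rw [← hterm x.1 x.2, mul_one, mul_one_div])
  rw [← mul_assoc, ← hz] at hall'
  rw [← hall', mul_div_cancel_left₀ _ hz0]
  exact hp.hasSum

/-! ### Cosets and primitive vectors -/

/-- The vector `v` is the last row of a matrix in `SL_{m+1}(ℤ)`. -/
def IsLastRow {m : ℕ} (v : Fin (m + 1) → ℤ) : Prop :=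
  ∃ γ : Matrix.SpecialLinearGroup (Fin (m + 1)) ℤ, γ.1 (Fin.last m) = v

theorem IsLastRow.update_add {m : ℕ} {v : Fin (m + 1) → ℤ} (hv : IsLastRow v)
    {i j : Fin (m + 1)} (hij : i ≠ j) (c : ℤ) :
    IsLastRow (Function.update v j (v j + c * v i)) := by
  obtain ⟨γ, rfl⟩ := hv
  refine ⟨γ * SpecialLinearGroup.transvection hij c, ?_⟩
  ext l
  change (γ.1 * Matrix.transvection i j c) (Fin.last m) l = _
  by_cases hl : l = j
  · subst hl
    simp
  · simp [hl]

theorem IsLastRow.of_update_add {m : ℕ} {v : Fin (m + 1) → ℤ} {i j : Fin (m + 1)} (hij : i ≠ j)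
    (c : ℤ) (hv : IsLastRow (Function.update v j (v j + c * v i))) : IsLastRow v := by
  have h := hv.update_add hij (-c)
  rw [Function.update_self, Function.update_of_ne hij, Function.update_idem] at h
  have : v j + c * v i + -c * v i = v j := by ring
  rwa [this, Function.update_eq_self] at h

theorem isLastRow_single_last {m : ℕ} : IsLastRow (Pi.single (Fin.last m) 1) :=
  ⟨1, by ext l; simp [Matrix.one_apply, Pi.single_apply, eq_comm]⟩

theorem isLastRow_single_of_ne {m : ℕ} {i : Fin (m + 1)} (hi : i ≠ Fin.last m) {a : ℤ}
    (ha : a * a = 1) : IsLastRow (Pi.single i a) := by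
  refine IsLastRow.of_update_add hi a (IsLastRow.of_update_add hi.symm (-a) ?_)
  convert isLastRow_single_last using 1
  ext l
  by_cases h1 : l = i
  · subst h1
    simp [hi, ha]
  · by_cases h2 : l = Fin.last m
    · subst h2
      simp [h1, ha, hi]
    · simp [h1, h2]

/-- A second coordinate is needed to change the sign of a unit vector by transvections; in size one
the only possible last row is 1. -/
theorem isLastRow_single {m : ℕ} (hm : 0 < m) (i : Fin (m + 1)) {a : ℤ}
    (ha : a * a = 1) : IsLastRow (Pi.single i a) := by
  by_cases hi : i = Fin.last m
  · subst hi
    have h0 : (0 : Fin (m + 1)) ≠ Fin.last m := by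
      intro h
      have := congrArg Fin.val h
      simp at this
      omega
    refine IsLastRow.of_update_add h0.symm 1 (IsLastRow.of_update_add h0 (-1) ?_)
    convert isLastRow_single_of_ne h0 ha using 1
    ext l
    by_cases h1 : l = 0
    · subst h1
      simp [h0]
    · by_cases h2 : l = Fin.last m
      · subst h2
        simp [h1]
      · simp [h1, h2]
  · exact isLastRow_single_of_ne hi ha

/-- Euclidean algorithm by column operations. While two entries are nonzero, reducing the larger
modulo the smaller decreases the sum of absolute values; in the end a single entry ±1 remains. -/
theorem isLastRow_of_primitive {m : ℕ} (hm : 0 < m) (v : Fin (m + 1) → ℤ)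
    (hv : ∀ d : ℤ, (∀ i, d ∣ v i) → d ∣ 1) : IsLastRow v := by
  induction hN : ∑ i, (v i).natAbs using Nat.strong_induction_on generalizing v with
  | _ N ih =>
    by_cases h : ∃ i j, i ≠ j ∧ v i ≠ 0 ∧ v j ≠ 0
    · obtain ⟨i, j, hij, hi, hle⟩ : ∃ i j, i ≠ j ∧ v i ≠ 0 ∧ (v i).natAbs ≤ (v j).natAbs := by
        obtain ⟨i, j, hij, hi, hj⟩ := h
        rcases le_total (v i).natAbs (v j).natAbs with h | h
        · exact ⟨i, j, hij, hi, h⟩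
        · exact ⟨j, i, hij.symm, hj, h⟩
      refine IsLastRow.of_update_add hij (-(v j / v i)) (ih _ ?_ _ ?_ rfl)
      · rw [← hN]
        refine Finset.sum_lt_sum (fun l _ => ?_) ⟨j, Finset.mem_univ j, ?_⟩
        · by_cases hl : l = j
          · subst hl
            have h1 : v l + -(v l / v i) * v i = v l % v i := by
              rw [Int.emod_def]; ring
            rw [Function.update_self, h1]
            have h2 := Int.emod_nonneg (v l) hi
            have h3 := Int.emod_lt_abs (v l) hi
            rw [Int.abs_eq_natAbs] at h3
            omega
          · simp [hl]
        · have h1 : v j + -(v j / v i) * v i = v j % v i := by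
            rw [Int.emod_def]; ring
          rw [Function.update_self, h1]
          have h2 := Int.emod_nonneg (v j) hi
          have h3 := Int.emod_lt_abs (v j) hi
          rw [Int.abs_eq_natAbs] at h3
          omega
      · intro d hd
        have hdi : d ∣ v i := by simpa [hij] using hd i
        refine hv d fun l => ?_
        by_cases hl : l = j
        · subst hl
          have := hd l
          rw [Function.update_self] at this
          exact (dvd_add_left (hdi.mul_left _)).1 this
        · simpa [hl] using hd l
    · push Not at h
      obtain ⟨i, hi⟩ : ∃ i, v i ≠ 0 := by
        by_contra! h0
        have := hv 0 fun i => by rw [h0 i]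
        simp at this
      have hs : v = Pi.single i (v i) := by
        ext l
        by_cases hl : l = i
        · subst hl; simp
        · simpa [hl] using h i l (Ne.symm hl) hi
      have h1 : v i ∣ 1 := hv _ fun l => by
        by_cases hl : l = i
        · subst hl; exact dvd_rfl
        · rw [h i l (Ne.symm hl) hi]; exact dvd_zero _
      rw [hs]
      exact isLastRow_single hm i (Int.isUnit_mul_self (isUnit_of_dvd_one h1))

theorem gcd_lastRow {m : ℕ} (γ : Matrix.SpecialLinearGroup (Fin (m + 1)) ℤ) :
    Finset.univ.gcd (γ.1 (Fin.last m)) = 1 := by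
  have h : (γ.1 * (γ⁻¹).1) (Fin.last m) (Fin.last m) = 1 := by
    rw [← Matrix.SpecialLinearGroup.coe_mul, mul_inv_cancel, Matrix.SpecialLinearGroup.coe_one,
      Matrix.one_apply_eq]
  have h1 : Finset.univ.gcd (γ.1 (Fin.last m)) ∣ 1 := by
    refine Dvd.dvd.trans ?_ (dvd_of_eq h)
    rw [Matrix.mul_apply]
    exact Finset.dvd_sum fun i _ => (Finset.gcd_dvd (Finset.mem_univ i)).mul_right _
  have h2 := Int.nonneg_of_normalize_eq_self
    (Finset.normalize_gcd (s := Finset.univ) (f := γ.1 (Fin.last m)))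
  exact Int.eq_one_of_dvd_one h2 h1

theorem mem_parabolicInt_iff {m : ℕ} (γ : Matrix.SpecialLinearGroup (Fin (m + 1)) ℤ) :
    γ ∈ parabolicInt (m + 1) ↔ Pi.single (Fin.last m) 1 ᵥ* γ.1 = Pi.single (Fin.last m) 1 := by
  constructor
  · intro h
    exact h (Fin.last m) (by simp)
  · intro h i hi
    obtain rfl : i = Fin.last m := Fin.ext (by simpa using hi)
    exact h

theorem mul_inv_mem_parabolicInt_iff {m : ℕ}
    (γ δ : Matrix.SpecialLinearGroup (Fin (m + 1)) ℤ) :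
    δ * γ⁻¹ ∈ parabolicInt (m + 1) ↔ γ.1 (Fin.last m) = δ.1 (Fin.last m) := by
  rw [mem_parabolicInt_iff, Matrix.SpecialLinearGroup.coe_mul, ← Matrix.vecMul_vecMul,
    Matrix.single_one_vecMul]
  have h1 : (γ⁻¹).1 * γ.1 = 1 := by
    rw [← Matrix.SpecialLinearGroup.coe_mul, inv_mul_cancel, Matrix.SpecialLinearGroup.coe_one]
  have h2 : γ.1 * (γ⁻¹).1 = 1 := by
    rw [← Matrix.SpecialLinearGroup.coe_mul, mul_inv_cancel, Matrix.SpecialLinearGroup.coe_one]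
  constructor
  · intro h
    have := congrArg (· ᵥ* γ.1) h
    simp only [Matrix.vecMul_vecMul, h1, Matrix.vecMul_one, Matrix.single_one_vecMul] at this
    exact this.symm
  · intro h
    change δ.1 (Fin.last m) ᵥ* (γ⁻¹).1 = _
    rw [← h]
    have : γ.1 (Fin.last m) = Pi.single (Fin.last m) 1 ᵥ* γ.1 := by
      rw [Matrix.single_one_vecMul]; rfl
    rw [this, Matrix.vecMul_vecMul, h2, Matrix.vecMul_one]

/-- Cosets of the parabolic subgroup correspond to primitive vectors, by taking the last row. -/
def cosetEquiv {m : ℕ} (hm : 0 < m) : CosetSpace (m + 1) ≃ PrimVec (m + 1) :=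
  Equiv.ofBijective (fun q => ⟨q.out.1 (Fin.last m), gcd_lastRow _⟩) <| by
    constructor
    · intro a b h
      have h := congrArg Subtype.val h
      rw [← Quotient.out_eq a, ← Quotient.out_eq b]
      exact Quotient.sound (QuotientGroup.rightRel_apply.2
        ((mul_inv_mem_parabolicInt_iff _ _).2 h))
    · rintro ⟨v, hv⟩
      obtain ⟨γ, hγ⟩ := isLastRow_of_primitive hm v fun d hd => by
        rw [← hv]
        exact Finset.dvd_gcd fun i _ => hd i
      refine ⟨Quotient.mk _ γ, Subtype.ext ?_⟩
      exact ((mul_inv_mem_parabolicInt_iff _ _).1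
        (QuotientGroup.rightRel_apply.1 (Quotient.mk_out γ))).trans hγ

/-! ### The Iwasawa decomposition -/

/-- The Cholesky decomposition, with an upper triangular first factor. -/
theorem exists_isPosTriangular_mul_transpose {n : ℕ} (S : Matrix (Fin n) (Fin n) ℝ)
    (hS : ∀ i j, S i j = S j i) (hpos : ∀ w : Fin n → ℝ, w ≠ 0 → 0 < ∑ i, ∑ j, w i * S i j * w j) :
    ∃ T : Matrix (Fin n) (Fin n) ℝ, IsPosTriangular T ∧ T * Tᵀ = S := by
  induction n with
  | zero => exact ⟨1, ⟨fun i => i.elim0, fun i => i.elim0⟩, by ext i; exact i.elim0⟩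
  | succ n ih =>
    set s := S (Fin.last n) (Fin.last n) with hs
    have hs0 : 0 < s := by
      have := hpos (Pi.single (Fin.last n) 1) (by simp)
      simpa [Pi.single_apply, Finset.sum_ite_eq] using this
    -- Induction through the Schur complement of the bottom right entry, which makes the factor
    -- upper rather than lower triangular.
    obtain ⟨T, hT, hTS⟩ := ih (Matrix.of fun i j => S i.castSucc j.castSucc -
        S i.castSucc (Fin.last n) * S j.castSucc (Fin.last n) / s)
      (fun i j => by simp only [Matrix.of_apply]; rw [hS i.castSucc j.castSucc]; ring)
      (fun w hw => by
        -- This last coordinate minimizes the form of `S` with `w` fixed, and the minimum is the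
        -- value of the Schur complement at `w`.
        set α := -(∑ i, w i * S i.castSucc (Fin.last n)) / s with hα
        have h := hpos (Fin.snoc (α := fun _ => ℝ) w α) (fun h0 => hw (by
          ext i
          have := congrFun h0 i.castSucc
          simpa using this))
        have key : ∑ i, ∑ j, w i * (S i.castSucc j.castSucc -
            S i.castSucc (Fin.last n) * S j.castSucc (Fin.last n) / s) * w j =
            ∑ i, ∑ j, w i * S i.castSucc j.castSucc * w j -
              (∑ i, w i * S i.castSucc (Fin.last n)) ^ 2 / s := by
          rw [sq, Finset.sum_mul_sum, Finset.sum_div, ← Finset.sum_sub_distrib]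
          refine Finset.sum_congr rfl fun i _ => ?_
          rw [Finset.sum_div, ← Finset.sum_sub_distrib]
          refine Finset.sum_congr rfl fun j _ => ?_
          ring
        simp only [Matrix.of_apply]
        rw [key]
        refine h.trans_eq ?_
        simp only [Fin.sum_univ_castSucc, Fin.snoc_castSucc, Fin.snoc_last]
        rw [Finset.sum_add_distrib]
        have e1 : ∑ i, w i * S i.castSucc (Fin.last n) * α =
            (∑ i, w i * S i.castSucc (Fin.last n)) * α := by rw [Finset.sum_mul]
        have e2 : ∑ j, α * S (Fin.last n) j.castSucc * w j =
            (∑ i, w i * S i.castSucc (Fin.last n)) * α := by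
          rw [Finset.sum_mul]
          refine Finset.sum_congr rfl fun j _ => ?_
          rw [hS (Fin.last n)]; ring
        rw [e1, e2, ← hs, hα]
        field_simp
        ring)
    have hd := Real.sqrt_pos.2 hs0
    have hdd := Real.mul_self_sqrt hs0.le
    set d := Real.sqrt s
    refine ⟨Matrix.of (Fin.snoc (α := fun _ => Fin (n + 1) → ℝ)
      (fun i => Fin.snoc (α := fun _ => ℝ) (T i) (S i.castSucc (Fin.last n) / d))
      (Fin.snoc (α := fun _ => ℝ) 0 d)), ⟨fun i j hij => ?_, fun i => ?_⟩, ?_⟩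
    · induction i using Fin.lastCases with
      | last =>
        induction j using Fin.lastCases with
        | last => exact absurd hij (lt_irrefl _)
        | cast j => simp
      | cast i =>
        induction j using Fin.lastCases with
        | last => exact absurd (hij.trans (Fin.castSucc_lt_last i)) (lt_irrefl _)
        | cast j => simpa using hT.eq_zero i j (Fin.castSucc_lt_castSucc_iff.1 hij)
    · induction i using Fin.lastCases with
      | last => simpa using hd
      | cast i => simpa using hT.pos i
    · ext i j
      have hTS' (i j : Fin n) : ∑ k, T i k * T j k = S i.castSucc j.castSucc -
          S i.castSucc (Fin.last n) * S j.castSucc (Fin.last n) / s := by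
        have := congrFun (congrFun hTS i) j
        simpa [Matrix.mul_apply] using this
      rw [Matrix.mul_apply, Fin.sum_univ_castSucc]
      induction i using Fin.lastCases with
      | last =>
        induction j using Fin.lastCases with
        | last => simp [hdd, hs]
        | cast j =>
          simp only [Matrix.transpose_apply, Matrix.of_apply, Fin.snoc_last, Fin.snoc_castSucc,
            Pi.zero_apply, zero_mul, Finset.sum_const_zero, zero_add]
          rw [hS (Fin.last n)]
          field_simp
      | cast i =>
        induction j using Fin.lastCases with
        | last =>
          simp only [Matrix.transpose_apply, Matrix.of_apply, Fin.snoc_last, Fin.snoc_castSucc,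
            Pi.zero_apply, mul_zero, Finset.sum_const_zero, zero_add]
          field_simp
        | cast j =>
          simp only [Matrix.transpose_apply, Matrix.of_apply, Fin.snoc_last, Fin.snoc_castSucc]
          rw [hTS', ← hdd]
          field_simp
          ring

theorem exists_isPosTriangular_mul_orthogonal {n : ℕ} {g : Matrix (Fin n) (Fin n) ℝ}
    (hg : g.det ≠ 0) : ∃ T : Matrix (Fin n) (Fin n) ℝ, IsPosTriangular T ∧
      ∃ k ∈ Matrix.orthogonalGroup (Fin n) ℝ, g = T * k := by
  obtain ⟨T, hT, hTS⟩ := exists_isPosTriangular_mul_transpose (g * gᵀ)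
    (fun i j => by simp [Matrix.mul_apply, mul_comm]) fun w hw => by
      have h : ∑ i, ∑ j, w i * (g * gᵀ) i j * w j = ∑ k, (w ᵥ* g) k ^ 2 := by
        calc ∑ i, ∑ j, w i * (g * gᵀ) i j * w j = w ⬝ᵥ ((g * gᵀ) *ᵥ w) := by
              simp only [dotProduct, Matrix.mulVec, Finset.mul_sum, mul_assoc]
          _ = (w ᵥ* g) ⬝ᵥ (w ᵥ* g) := by
              rw [← Matrix.mulVec_mulVec, Matrix.dotProduct_mulVec, Matrix.mulVec_transpose]
          _ = _ := by simp only [dotProduct, sq]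
      rw [h]
      refine lt_of_le_of_ne (Finset.sum_nonneg fun _ _ => sq_nonneg _) fun h0 => hw ?_
      refine Matrix.eq_zero_of_vecMul_eq_zero hg (funext fun j => ?_)
      have := (Finset.sum_eq_zero_iff_of_nonneg (fun _ _ => sq_nonneg _)).1 h0.symm j
        (Finset.mem_univ j)
      simpa using this
  have hu : IsUnit T.det := hT.det_pos.ne'.isUnit
  refine ⟨T, hT, T⁻¹ * g, ?_, by rw [Matrix.mul_nonsing_inv_cancel_left _ _ hu]⟩
  rw [Matrix.mem_orthogonalGroup_iff,
    Matrix.transpose_mul, Matrix.mul_assoc, ← Matrix.mul_assoc g, ← hTS, Matrix.mul_assoc,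
    Matrix.transpose_nonsing_inv, Matrix.mul_nonsing_inv _ (by rwa [Matrix.det_transpose]),
    Matrix.mul_one, Matrix.nonsing_inv_mul _ hu]

theorem prod_fin_filter_eq_prod_range {m : ℕ} (f : ℕ → ℝ) (i : Fin (m + 1)) :
    ∏ k : Fin m with k.val + i.val + 1 < m + 1, f k = ∏ k ∈ Finset.range (m - i), f k := by
  rw [Finset.prod_filter, Fin.prod_univ_eq_prod_range
    (fun k => if k + i.val + 1 < m + 1 then f k else 1) m, ← Finset.prod_filter]
  congr 1
  ext k
  simp only [Finset.mem_filter, Finset.mem_range]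
  omega

theorem IsPosTriangular.exists_iwasawa {m : ℕ} {T : Matrix (Fin (m + 1)) (Fin (m + 1)) ℝ}
    (hT : IsPosTriangular T) : ∃ (x : Fin (m + 1) → Fin (m + 1) → ℝ) (y : Fin m → ℝ)
      (hy : ∀ k, 0 < y k), T = T (Fin.last m) (Fin.last m) •
        (iwasawa (n := m + 1) x y hy : Matrix (Fin (m + 1)) (Fin (m + 1)) ℝ) := by
  set r := T (Fin.last m) (Fin.last m) with hr
  have hr0 : 0 < r := hT.pos _
  -- `Y j` is the normalized diagonal entry counted from the bottom, hence the required product y_1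
  -- ⋯ y_j; consecutive quotients give the coordinates.
  set Y : ℕ → ℝ := fun j => T (Fin.ofNat (m + 1) (m - j)) (Fin.ofNat (m + 1) (m - j)) / r with hY
  have hYpos (j : ℕ) : 0 < Y j := div_pos (hT.pos _) hr0
  have hY0 : Y 0 = 1 := by
    have : Fin.ofNat (m + 1) m = Fin.last m := by ext; simp
    simp only [hY, tsub_zero, this]
    exact div_self hr0.ne'
  refine ⟨fun i j => T i j / T j j, fun k => Y (k + 1) / Y k,
    fun k => div_pos (hYpos _) (hYpos _), ?_⟩
  have hdiag (i : Fin (m + 1)) :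
      diagEntry (n := m + 1) (fun k : Fin m => Y (k + 1) / Y k) i = T i i / r := by
    refine (prod_fin_filter_eq_prod_range (fun k => Y (k + 1) / Y k) i).trans ?_
    have hprod (l : ℕ) : ∏ k ∈ Finset.range l, Y (k + 1) / Y k = Y l := by
      induction l with
      | zero => simp [hY0]
      | succ l ih => rw [Finset.prod_range_succ, ih, mul_div_cancel₀ _ (hYpos l).ne']
    rw [hprod]
    have : Fin.ofNat (m + 1) (m - (m - i.val)) = i := by
      ext
      have := i.isLt
      rw [Fin.val_ofNat, Nat.mod_eq_of_lt (by omega)]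
      omega
    simp only [hY, this]
  ext i j
  change T i j = r * (unip (fun i j => T i j / T j j) *
    Matrix.diagonal (diagEntry (n := m + 1) fun k : Fin m => Y (k + 1) / Y k)) i j
  rw [Matrix.mul_diagonal, hdiag]
  have := (hT.pos j).ne'
  simp only [unip, Matrix.of_apply]
  split_ifs with h1 h2
  · subst h1
    field_simp
  · field_simp
  · rw [hT.eq_zero i j (lt_of_le_of_ne (not_lt.1 h2) (Ne.symm h1))]
    simp

theorem exists_mk_iwasawa {m : ℕ} (z : UpperHalf (m + 1)) :
    ∃ y : Fin m → ℝ, ∃ hy : ∀ k, 0 < y k, ∃ x : Fin (m + 1) → Fin (m + 1) → ℝ,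
      (QuotientGroup.mk (iwasawa (n := m + 1) x y hy) : UpperHalf (m + 1)) = z := by
  induction z using QuotientGroup.induction_on with | H g =>
  have hg : (g : Matrix (Fin (m + 1)) (Fin (m + 1)) ℝ).det ≠ 0 :=
    ((Matrix.isUnit_iff_isUnit_det _).1 g.isUnit).ne_zero
  obtain ⟨T, hT, k, hk, hgT⟩ := exists_isPosTriangular_mul_orthogonal hg
  obtain ⟨x, y, hy, hTb⟩ := hT.exists_iwasawa
  refine ⟨y, hy, x, QuotientGroup.eq.2 ⟨T (Fin.last m) (Fin.last m), (hT.pos _).ne', k, hk, ?_⟩⟩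
  rw [Units.val_mul, hgT, hTb, smul_mul_assoc, mul_smul_comm, ← mul_assoc, Units.inv_mul,
    Matrix.one_mul, ← hTb]

theorem isPosTriangular_iwasawa {n : ℕ} (x : Fin n → Fin n → ℝ) (y : Fin (n - 1) → ℝ)
    (hy : ∀ k, 0 < y k) :
    IsPosTriangular (iwasawa x y hy : Matrix (Fin n) (Fin n) ℝ) where
  eq_zero i j hij := by
    change (unip x * Matrix.diagonal (diagEntry y)) i j = 0
    simp [Matrix.mul_diagonal, unip, hij.ne', hij.not_gt]
  pos i := by
    change 0 < (unip x * Matrix.diagonal (diagEntry y)) i i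
    simpa [Matrix.mul_diagonal, unip] using diagEntry_pos hy i

theorem diagEntry_last {m : ℕ} (y : Fin m → ℝ) :
    diagEntry (n := m + 1) y (Fin.last m) = 1 := by
  refine Finset.prod_eq_one fun k hk => absurd (Finset.mem_filter.1 hk).2 ?_
  simp

theorem iwasawa_apply_self {n : ℕ} (x : Fin n → Fin n → ℝ) (y : Fin (n - 1) → ℝ)
    (hy : ∀ k, 0 < y k) (i : Fin n) :
    (iwasawa x y hy : Matrix (Fin n) (Fin n) ℝ) i i = diagEntry y i := by
  change (unip x * Matrix.diagonal (diagEntry y)) i i = _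
  simp [Matrix.mul_diagonal, unip]

theorem det_iwasawa {m : ℕ} (x : Fin (m + 1) → Fin (m + 1) → ℝ) (y : Fin m → ℝ)
    (hy : ∀ k, 0 < y k) :
    (iwasawa (n := m + 1) x y hy : Matrix (Fin (m + 1)) (Fin (m + 1)) ℝ).det =
      ∏ i : Fin (m + 1) with i.val + 1 < m + 1, diagEntry (n := m + 1) y i := by
  rw [(isPosTriangular_iwasawa (n := m + 1) x y hy).det_eq, Finset.prod_filter]
  refine Finset.prod_congr rfl fun i _ => ?_
  rw [iwasawa_apply_self]
  split_ifs with h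
  · rfl
  · obtain rfl : i = Fin.last m := by
      ext; have := i.isLt; simp only [Fin.val_last]; omega
    exact diagEntry_last y

theorem sum_sq_orthogonal {n : ℕ} (w : Fin n → ℝ) {k : Matrix (Fin n) (Fin n) ℝ}
    (hk : k ∈ Matrix.orthogonalGroup (Fin n) ℝ) : ∑ j, (w ᵥ* k) j ^ 2 = ∑ j, w j ^ 2 := by
  have h (v : Fin n → ℝ) : ∑ j, v j ^ 2 = v ⬝ᵥ v := by simp [dotProduct, sq]
  rw [Matrix.mem_orthogonalGroup_iff] at hk
  rw [h, h]
  nth_rw 2 [← Matrix.mulVec_transpose]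
  rw [Matrix.dotProduct_mulVec, Matrix.vecMul_vecMul, hk, Matrix.vecMul_one]

theorem abs_det_orthogonal {n : ℕ} {k : Matrix (Fin n) (Fin n) ℝ}
    (hk : k ∈ Matrix.orthogonalGroup (Fin n) ℝ) : |k.det| = 1 := by
  have h := congrArg Matrix.det ((Matrix.mem_orthogonalGroup_iff (Fin n) ℝ).1 hk)
  rw [Matrix.det_mul, Matrix.det_transpose, Matrix.det_one] at h
  have := abs_mul_abs_self k.det
  rw [h] at this
  nlinarith [abs_nonneg k.det]

theorem pow_cpow_ofReal {r : ℝ} (hr : 0 < r) (k : ℕ) (s : ℂ) :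
    ((r ^ k : ℝ) : ℂ) ^ s = (r : ℂ) ^ ((k : ℂ) * s) := by
  induction k with
  | zero => simp
  | succ k ih =>
    rw [pow_succ, ofReal_mul, mul_cpow_ofReal_nonneg (by positivity) hr.le, ih,
      ← cpow_add _ _ (ofReal_ne_zero.2 hr.ne')]
    congr 1
    push_cast
    ring

/-- The right-hand side is unchanged when `g` is multiplied by an orthogonal matrix or a scalar. On
an Iwasawa form the last row is a unit vector and only the determinant is left. -/
theorem iFunction_mk {m : ℕ} (s : ℂ) (g : GL (Fin (m + 1)) ℝ) :
    iFunction s (QuotientGroup.mk g : UpperHalf (m + 1)) =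
      ((|(g : Matrix (Fin (m + 1)) (Fin (m + 1)) ℝ).det| : ℝ) : ℂ) ^ s *
        (1 / ((∑ j, (g : Matrix (Fin (m + 1)) (Fin (m + 1)) ℝ) (Fin.last m) j ^ 2 : ℝ) : ℂ) ^
          (((m + 1 : ℕ) : ℂ) * s / 2)) := by
  have hex : ∃ y : Fin (m + 1 - 1) → ℝ, ∃ hy : ∀ k, 0 < y k,
      ∃ x : Fin (m + 1) → Fin (m + 1) → ℝ,
      (QuotientGroup.mk (iwasawa x y hy) : UpperHalf (m + 1)) = QuotientGroup.mk g :=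
    exists_mk_iwasawa _
  obtain ⟨hy, x, hxy⟩ := hex.choose_spec
  have hyc : yCoord (QuotientGroup.mk g : UpperHalf (m + 1)) = hex.choose := dif_pos hex
  rw [iFunction, hyc]
  set y := hex.choose
  obtain ⟨c, hc, k, hk, hck⟩ := QuotientGroup.eq.1 hxy
  set b := iwasawa x y hy with hb
  have hg : (g : Matrix (Fin (m + 1)) (Fin (m + 1)) ℝ) =
      c • ((b : Matrix (Fin (m + 1)) (Fin (m + 1)) ℝ) * k) := by
    rw [← mul_smul_comm, ← hck, Units.val_mul, ← mul_assoc, Units.mul_inv, Matrix.one_mul]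
  have hbT := isPosTriangular_iwasawa x y hy
  have hdet : |(g : Matrix (Fin (m + 1)) (Fin (m + 1)) ℝ).det| =
      |c| ^ (m + 1) * (b : Matrix (Fin (m + 1)) (Fin (m + 1)) ℝ).det := by
    rw [hg, Matrix.det_smul, Matrix.det_mul, abs_mul, abs_mul, abs_det_orthogonal hk, mul_one,
      abs_of_pos hbT.det_pos, abs_pow, Fintype.card_fin]
  have hrow : ∑ j, (g : Matrix (Fin (m + 1)) (Fin (m + 1)) ℝ) (Fin.last m) j ^ 2 = |c| ^ 2 := by
    have h1 : (b : Matrix (Fin (m + 1)) (Fin (m + 1)) ℝ) (Fin.last m) =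
        Pi.single (Fin.last m) 1 := by
      ext j
      by_cases hj : j = Fin.last m
      · subst hj
        rw [hb, iwasawa_apply_self, Pi.single_eq_same]
        exact diagEntry_last y
      · rw [Pi.single_eq_of_ne hj]
        exact hbT.eq_zero _ _ (lt_of_le_of_ne (Fin.le_last j) hj)
    have h2 (j) : (g : Matrix (Fin (m + 1)) (Fin (m + 1)) ℝ) (Fin.last m) j =
        c * ((b : Matrix (Fin (m + 1)) (Fin (m + 1)) ℝ) (Fin.last m) ᵥ* k) j := by
      rw [hg]; rfl
    simp only [h2, mul_pow, ← Finset.mul_sum]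
    rw [sum_sq_orthogonal _ hk, h1, sq_abs]
    simp [Pi.single_apply]
  have hlast : ∏ i : Fin (m + 1) with i.val + 1 = m + 1, diagEntry y i = 1 := by
    refine Finset.prod_eq_one fun i hi => ?_
    obtain rfl : i = Fin.last m := Fin.ext (by simpa using (Finset.mem_filter.1 hi).2)
    exact diagEntry_last y
  have hc0 : (0 : ℝ) < |c| := abs_pos.2 hc
  have hcc : ((|c| : ℝ) : ℂ) ≠ 0 := ofReal_ne_zero.2 hc0.ne'
  rw [hlast, ofReal_one, one_cpow, mul_one, hdet, hrow, hb, det_iwasawa, ofReal_mul,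
    mul_cpow_ofReal_nonneg (by positivity) (Finset.prod_nonneg fun i _ => (diagEntry_pos hy i).le)]
  have h1 : ((|c| ^ (m + 1) : ℝ) : ℂ) ^ s = ((|c| : ℝ) : ℂ) ^ (((m + 1 : ℕ) : ℂ) * s) := pow_cpow_ofReal hc0 _ _
  have h2 : ((|c| ^ 2 : ℝ) : ℂ) ^ (((m + 1 : ℕ) : ℂ) * s / 2) =
      ((|c| : ℝ) : ℂ) ^ (((m + 1 : ℕ) : ℂ) * s) := by
    rw [pow_cpow_ofReal hc0]
    congr 1
    push_cast
    ring
  rw [h1, h2]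
  have h3 : ((|c| : ℝ) : ℂ) ^ (((m + 1 : ℕ) : ℂ) * s) ≠ 0 := by simp [cpow_eq_zero_iff, hc]
  field_simp

/-! ### Meromorphic continuation -/

theorem eisensteinTerm_mk {m : ℕ} (hm : 0 < m) (g : GL (Fin (m + 1)) ℝ)
    (hg : 0 < (g : Matrix (Fin (m + 1)) (Fin (m + 1)) ℝ).det) (s : ℂ) (q : CosetSpace (m + 1)) :
    eisensteinTerm (QuotientGroup.mk g : UpperHalf (m + 1)) s q =
      (((g : Matrix (Fin (m + 1)) (Fin (m + 1)) ℝ).det : ℝ) : ℂ) ^ s *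
        (1 / (rowQ (g : Matrix (Fin (m + 1)) (Fin (m + 1)) ℝ) (cosetEquiv hm q).1 : ℂ) ^
          (((m + 1 : ℕ) : ℂ) * s / 2)) := by
  set γ : GL (Fin (m + 1)) ℝ := Matrix.SpecialLinearGroup.mapGL ℝ q.out with hγ
  have h0 : eisensteinTerm (QuotientGroup.mk g : UpperHalf (m + 1)) s q =
      iFunction s (QuotientGroup.mk (γ * g) : UpperHalf (m + 1)) := rfl
  have hdet : ((γ * g : GL (Fin (m + 1)) ℝ) : Matrix (Fin (m + 1)) (Fin (m + 1)) ℝ).det =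
      (g : Matrix (Fin (m + 1)) (Fin (m + 1)) ℝ).det := by
    have h1 : (γ : Matrix (Fin (m + 1)) (Fin (m + 1)) ℝ).det = 1 := by
      have := congrArg Units.val (Matrix.SpecialLinearGroup.det_mapGL (S := ℝ) q.out)
      exact this
    rw [Units.val_mul, Matrix.det_mul, h1, one_mul]
  rw [h0, iFunction_mk, hdet, abs_of_pos hg]
  rfl

/-- The entire function `w (w - 1) ξ(w)`. -/
def xiEntire (w : ℂ) : ℂ := w * (w - 1) * completedRiemannZeta₀ w + 1

theorem differentiable_xiEntire : Differentiable ℂ xiEntire :=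
  ((differentiable_id.mul (differentiable_id.sub_const 1)).mul
    differentiable_completedZeta₀).add_const 1

theorem xiEntire_eq {w : ℂ} (h0 : w ≠ 0) (h1 : w ≠ 1) :
    xiEntire w = w * (w - 1) * completedRiemannZeta w := by
  have h2 : 1 - w ≠ 0 := sub_ne_zero.2 h1.symm
  rw [completedRiemannZeta_eq, xiEntire]
  field_simp
  ring

/-- The points 0 and 1 are poles of ξ, cancelled by the factors w and w - 1 with value 1; the values
of `completedRiemannZeta` there play no role. -/
theorem xiEntire_ne_zero {w : ℂ} (h : w = 0 ∨ w = 1 ∨ completedRiemannZeta w ≠ 0) :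
    xiEntire w ≠ 0 := by
  by_cases h0 : w = 0
  · simp [h0, xiEntire]
  by_cases h1 : w = 1
  · simp [h1, xiEntire]
  rw [xiEntire_eq h0 h1]
  exact mul_ne_zero (mul_ne_zero h0 (sub_ne_zero.2 h1)) (by tauto)

theorem completedRiemannZeta_ne_zero_of_one_lt_re {w : ℂ} (hw : 1 < w.re) :
    completedRiemannZeta w ≠ 0 := by
  intro h
  have h0 : w ≠ 0 := by rintro rfl; simp at hw; linarith
  apply riemannZeta_ne_zero_of_one_lt_re hw
  rw [riemannZeta_def_of_ne_zero h0, h, zero_div]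

/-- The numerator of the continued Eisenstein series `E(z, s)`, whose denominator is `xiEntire`;
`L` is the entire part of the completed Epstein zeta function of `z` and `D` is the determinant. -/
def eisensteinNum (n : ℕ) (D : ℝ) (L : ℂ → ℂ) (s : ℂ) : ℂ :=
  (D : ℂ) ^ s * (n * s * (n * s - 1) * L (n * s / 2) - 2 * (n * s - 1) -
    2 * (n * s) * (n * s - 1) * (D : ℂ)⁻¹ / (n * (1 - s)))

/-- The continuation of the Eisenstein series, up to its values at removable singularities. -/
def eisensteinCont (n : ℕ) (D : ℝ) (L : ℂ → ℂ) (s : ℂ) : ℂ :=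
  eisensteinNum n D L s / xiEntire (n * s)

theorem meromorphicAt_eisensteinNum (n : ℕ) {D : ℝ} (hD : 0 < D) {L : ℂ → ℂ}
    (hL : Differentiable ℂ L) (s : ℂ) : MeromorphicAt (eisensteinNum n D L) s := by
  have h1 : Differentiable ℂ fun s : ℂ => (D : ℂ) ^ s := fun s =>
    (differentiableAt_id.const_cpow (Or.inl (ofReal_ne_zero.2 hD.ne')))
  have h2 : Differentiable ℂ fun s : ℂ => n * s * (n * s - 1) * L (n * s / 2) -
      2 * (n * s - 1) := by fun_prop
  have h3 : Differentiable ℂ fun s : ℂ => 2 * (n * s) * (n * s - 1) * (D : ℂ)⁻¹ := by fun_prop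
  have h4 : Differentiable ℂ fun s : ℂ => n * (1 - s) := by fun_prop
  exact (h1.analyticAt s).meromorphicAt.mul ((h2.analyticAt s).meromorphicAt.sub
    ((h3.analyticAt s).meromorphicAt.div (h4.analyticAt s).meromorphicAt))

theorem analyticAt_eisensteinNum {n : ℕ} (hn : 0 < n) {D : ℝ} (hD : 0 < D) {L : ℂ → ℂ}
    (hL : Differentiable ℂ L) {s : ℂ} (hs : s ≠ 1) : AnalyticAt ℂ (eisensteinNum n D L) s := by
  have h1 : Differentiable ℂ fun s : ℂ => (D : ℂ) ^ s := fun s =>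
    (differentiableAt_id.const_cpow (Or.inl (ofReal_ne_zero.2 hD.ne')))
  have h2 : Differentiable ℂ fun s : ℂ => n * s * (n * s - 1) * L (n * s / 2) -
      2 * (n * s - 1) := by fun_prop
  have h3 : Differentiable ℂ fun s : ℂ => 2 * (n * s) * (n * s - 1) * (D : ℂ)⁻¹ := by fun_prop
  have h4 : Differentiable ℂ fun s : ℂ => n * (1 - s) := by fun_prop
  exact (h1.analyticAt s).mul ((h2.analyticAt s).sub ((h3.analyticAt s).div (h4.analyticAt s)
    (mul_ne_zero (Nat.cast_ne_zero.2 hn.ne') (sub_ne_zero.2 hs.symm))))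

theorem differentiable_xiEntire_comp (n : ℕ) : Differentiable ℂ fun s : ℂ => xiEntire (n * s) :=
  differentiable_xiEntire.comp (by fun_prop)

theorem meromorphicOn_eisensteinCont (n : ℕ) {D : ℝ} (hD : 0 < D) {L : ℂ → ℂ}
    (hL : Differentiable ℂ L) : MeromorphicOn (eisensteinCont n D L) univ := fun s _ =>
  (meromorphicAt_eisensteinNum n hD hL s).div
    ((differentiable_xiEntire_comp n).analyticAt s).meromorphicAt

theorem analyticAt_eisensteinCont {n : ℕ} (hn : 0 < n) {D : ℝ} (hD : 0 < D) {L : ℂ → ℂ}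
    (hL : Differentiable ℂ L) {s : ℂ} (hs : s ≠ 1) (hs' : xiEntire (n * s) ≠ 0) :
    AnalyticAt ℂ (eisensteinCont n D L) s :=
  (analyticAt_eisensteinNum hn hD hL hs).div ((differentiable_xiEntire_comp n).analyticAt s) hs'

/-- Numerator and denominator are both multiplied by ns(ns - 1). This absorbs the pole of Λ(ns/2) at
s = 0, so that besides the zeros of ξ(ns) only s = 1 can be singular. -/
theorem IsPosTriangular.eisensteinCont_eq {n : ℕ} {g : Matrix (Fin n) (Fin n) ℝ}
    (hg : IsPosTriangular g) (hn : 0 < n) {s : ℂ} (hs : s ≠ 1) (h0 : n * s ≠ 0)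
    (h1 : n * s ≠ 1) :
    eisensteinCont n g.det (hg.pair hn).Λ₀ s =
      (g.det : ℂ) ^ s * ((hg.pair hn).Λ (n * s / 2) / completedRiemannZeta (n * s)) := by
  have hn0 : (n : ℂ) ≠ 0 := Nat.cast_ne_zero.2 hn.ne'
  have hs1 : 1 - s ≠ 0 := sub_ne_zero.2 hs.symm
  have hs0 : s ≠ 0 := right_ne_zero_of_mul h0
  have hk : (hg.pair hn).Λ (n * s / 2) = (hg.pair hn).Λ₀ (n * s / 2) - 2 / (n * s) -
      2 * (g.det : ℂ)⁻¹ / (n * (1 - s)) := by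
    have : (hg.pair hn).Λ (n * s / 2) = (hg.pair hn).Λ₀ (n * s / 2) -
        (1 / (n * s / 2)) * 1 - (1 / (((n / 2 : ℝ) : ℂ) - n * s / 2)) * ((g.det⁻¹ : ℝ) : ℂ) := rfl
    rw [this]
    have h2 : (((n / 2 : ℝ) : ℂ) - n * s / 2) = n * (1 - s) / 2 := by push_cast; ring
    rw [h2]
    push_cast
    field_simp
  have hw : (n : ℂ) * s - 1 ≠ 0 := sub_ne_zero.2 h1
  rw [eisensteinCont, xiEntire_eq h0 h1, ← mul_div_assoc,
    ← mul_div_mul_left _ (completedRiemannZeta (n * s)) (mul_ne_zero h0 hw)]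
  congr 1
  have hD : (g.det : ℂ) ≠ 0 := ofReal_ne_zero.2 hg.det_pos.ne'
  rw [hk, eisensteinNum]
  field_simp

theorem hasSum_eisensteinTerm {m : ℕ} (hm : 0 < m) (g : GL (Fin (m + 1)) ℝ)
    (hg : IsPosTriangular (g : Matrix (Fin (m + 1)) (Fin (m + 1)) ℝ)) {s : ℂ} (hs : 1 < s.re) :
    HasSum (eisensteinTerm (QuotientGroup.mk g : UpperHalf (m + 1)) s)
      (eisensteinCont (m + 1) (g : Matrix (Fin (m + 1)) (Fin (m + 1)) ℝ).det
        (hg.pair m.succ_pos).Λ₀ s) := by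
  have hre : (((m + 1 : ℕ) : ℂ) * s).re = ((m + 1 : ℕ) : ℝ) * s.re := by
    rw [← ofReal_natCast, re_ofReal_mul]
  have hn : (1 : ℝ) ≤ ((m + 1 : ℕ) : ℝ) := by exact_mod_cast m.succ_pos
  have hre2 : (((m + 1 : ℕ) : ℂ) * s / 2).re = ((m + 1 : ℕ) : ℝ) * s.re / 2 := by
    rw [← hre, div_ofNat_re]
  have hw : 1 < (((m + 1 : ℕ) : ℂ) * s).re := by rw [hre]; nlinarith
  rw [hg.eisensteinCont_eq m.succ_pos (by rintro rfl; simp at hs)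
    (by intro h; rw [h] at hw; simp at hw; linarith) (by intro h; rw [h] at hw; simp at hw)]
  have h := hg.hasSum_primVec m.succ_pos (u := ((m + 1 : ℕ) : ℂ) * s / 2)
    (by rw [hre2]; nlinarith) (by rw [hre2]; nlinarith)
  rw [mul_div_cancel₀ _ two_ne_zero, ← (cosetEquiv hm).hasSum_iff] at h
  exact (h.mul_left _).congr_fun fun q => eisensteinTerm_mk hm g hg.det_pos s q

theorem exists_isPosTriangular_mk {m : ℕ} (z : UpperHalf (m + 1)) :
    ∃ g : GL (Fin (m + 1)) ℝ, IsPosTriangular (g : Matrix (Fin (m + 1)) (Fin (m + 1)) ℝ) ∧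
      QuotientGroup.mk g = z := by
  obtain ⟨y, hy, x, h⟩ := exists_mk_iwasawa z
  exact ⟨_, isPosTriangular_iwasawa (n := m + 1) x y hy, h⟩

theorem xiEntire_mul_ne_zero_of_one_lt_re {n : ℕ} (hn : 0 < n) {s : ℂ} (hs : 1 < s.re) :
    xiEntire (n * s) ≠ 0 := by
  refine xiEntire_ne_zero (Or.inr (Or.inr (completedRiemannZeta_ne_zero_of_one_lt_re ?_)))
  rw [← ofReal_natCast, re_ofReal_mul]
  have : (1 : ℝ) ≤ n := by exact_mod_cast hn
  nlinarith

theorem exists_isEisenstein {m : ℕ} (hm : 0 < m) (z : UpperHalf (m + 1)) :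
    ∃ F, IsEisenstein z F := by
  obtain ⟨g, hg, rfl⟩ := exists_isPosTriangular_mk z
  have hmer := meromorphicOn_eisensteinCont (m + 1) hg.det_pos
    (hg.pair m.succ_pos).differentiable_Λ₀
  refine ⟨toMeromorphicNFOn _ univ, meromorphicNFOn_toMeromorphicNFOn (f := eisensteinCont (m + 1)
    (g : Matrix (Fin (m + 1)) (Fin (m + 1)) ℝ).det (hg.pair m.succ_pos).Λ₀) (U := univ),
    fun s hs => ?_⟩
  have ha := analyticAt_eisensteinCont m.succ_pos hg.det_pos
    (hg.pair m.succ_pos).differentiable_Λ₀ (s := s) (by rintro rfl; simp at hs)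
    (xiEntire_mul_ne_zero_of_one_lt_re m.succ_pos hs)
  rw [toMeromorphicNFOn_eq_toMeromorphicNFAt hmer (mem_univ s),
    toMeromorphicNFAt_eq_self.2 ha.meromorphicNFAt]
  exact hasSum_eisensteinTerm hm g hg hs

theorem isEisenstein_eisenstein {m : ℕ} (hm : 0 < m) (z : UpperHalf (m + 1)) :
    IsEisenstein z (eisenstein z) := by
  have h := exists_isEisenstein hm z
  rw [eisenstein, dif_pos h]
  exact h.choose_spec

/-- Identity theorem for meromorphic functions on the plane. -/
theorem eventuallyEq_nhdsNE_of_eventuallyEq {F G : ℂ → ℂ} (hF : MeromorphicOn F univ)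
    (hG : MeromorphicOn G univ) {a : ℂ} (h : F =ᶠ[𝓝 a] G) (s : ℂ) : F =ᶠ[𝓝[≠] s] G := by
  have hsub : MeromorphicOn (F - G) univ := hF.sub hG
  have htop : meromorphicOrderAt (F - G) a = ⊤ := by
    rw [meromorphicOrderAt_eq_top_iff]
    filter_upwards [h.filter_mono nhdsWithin_le_nhds] with x hx
    simp [hx]
  have hs : meromorphicOrderAt (F - G) s = ⊤ := by
    by_contra hne
    exact hsub.meromorphicOrderAt_ne_top_of_isPreconnected isPreconnected_univ (mem_univ s)
      (mem_univ a) hne htop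
  filter_upwards [meromorphicOrderAt_eq_top_iff.1 hs] with x hx
  exact sub_eq_zero.1 hx

theorem eisenstein_mk_eventuallyEq {m : ℕ} (hm : 0 < m) (g : GL (Fin (m + 1)) ℝ)
    (hg : IsPosTriangular (g : Matrix (Fin (m + 1)) (Fin (m + 1)) ℝ)) {s : ℂ} (hs : s ≠ 1)
    (hs' : xiEntire ((m + 1 : ℕ) * s) ≠ 0) :
    eisenstein (QuotientGroup.mk g : UpperHalf (m + 1)) =ᶠ[𝓝 s]
      eisensteinCont (m + 1) (g : Matrix (Fin (m + 1)) (Fin (m + 1)) ℝ).det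
        (hg.pair m.succ_pos).Λ₀ := by
  have hE := isEisenstein_eisenstein hm (QuotientGroup.mk g : UpperHalf (m + 1))
  have hL := (hg.pair m.succ_pos).differentiable_Λ₀
  refine ((hE.1 (mem_univ s)).eventuallyEq_nhdsNE_iff_eventuallyEq_nhds
    (analyticAt_eisensteinCont m.succ_pos hg.det_pos hL hs hs').meromorphicNFAt).1 ?_
  -- Any point of the half plane of convergence serves as the seed; near 2 both functions are the
  -- sum of the series. Normal form then upgrades equality near `s` to equality at `s`.
  refine eventuallyEq_nhdsNE_of_eventuallyEq (fun x hx => (hE.1 hx).meromorphicAt)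
    (meromorphicOn_eisensteinCont (m + 1) hg.det_pos hL) (a := 2) ?_ s
  filter_upwards [(isOpen_lt continuous_const continuous_re).mem_nhds
    (show (1 : ℝ) < (2 : ℂ).re by simp)] with w hw
  exact (hE.2 w hw).unique (hasSum_eisensteinTerm hm g hg hw)

/-! ### Averages over the unit cube -/

theorem continuous_evenKernel {x : ℝ} (hx : 0 < x) :
    Continuous fun a : ℝ => evenKernel (a : UnitAddCircle) x := by
  have h : Continuous fun a : ℝ => ((evenKernel (a : UnitAddCircle) x : ℝ) : ℂ) := by
    simp only [evenKernel_def]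
    refine Continuous.mul (by fun_prop) (continuous_iff_continuousAt.2 fun a => ?_)
    exact (continuousAt_jacobiTheta₂ (a * I * x) (by simpa using hx)).comp
      (f := fun a : ℝ => ((a : ℂ) * I * x, I * (x : ℂ))) (by fun_prop)
  exact (continuous_re.comp h).congr fun a => ofReal_re _

/-- The unit cube in `ℝ^m`. -/
def cube (m : ℕ) : Set (Fin m → ℝ) := Set.univ.pi fun _ => Set.Ioc 0 1

theorem volume_cube (m : ℕ) : volume (cube m) = 1 := by
  simp [cube, volume_pi_pi]

instance isProbabilityMeasure_cube (m : ℕ) :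
    IsProbabilityMeasure ((volume : Measure (Fin m → ℝ)).restrict (cube m)) :=
  ⟨by rw [Measure.restrict_apply_univ]; exact volume_cube m⟩

theorem integral_exp_two_pi_Ioc {N : ℤ} (hN : N ≠ 0) :
    ∫ t in Ioc (0 : ℝ) 1, cexp (2 * Real.pi * I * N * t) = 0 := by
  have hc : 2 * (Real.pi : ℂ) * I * N ≠ 0 :=
    mul_ne_zero two_pi_I_ne_zero (Int.cast_ne_zero.2 hN)
  rw [← intervalIntegral.integral_of_le zero_le_one, integral_exp_mul_complex hc]
  have : cexp (2 * Real.pi * I * N) = 1 := by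
    rw [mul_comm]
    exact exp_int_mul_two_pi_mul_I N
  simp [this]

theorem integral_exp_cube {m : ℕ} {v : Fin m → ℤ} (hv : v ≠ 0) {k : ℤ} (hk : k ≠ 0) :
    ∫ t : Fin m → ℝ in cube m,
      cexp (2 * Real.pi * I * ((∑ i, (v i : ℝ) * t i : ℝ) : ℂ) * k) = 0 := by
  obtain ⟨i, hi⟩ := Function.ne_iff.1 hv
  have h (t : Fin m → ℝ) : cexp (2 * Real.pi * I * ((∑ i, (v i : ℝ) * t i : ℝ) : ℂ) * k) =
      ∏ i, cexp (2 * Real.pi * I * ((v i * k : ℤ) : ℂ) * t i) := by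
    rw [← Complex.exp_sum]
    congr 1
    push_cast
    rw [Finset.mul_sum, Finset.sum_mul]
    refine Finset.sum_congr rfl fun i _ => ?_
    ring
  have hr : (volume : Measure (Fin m → ℝ)).restrict (cube m) =
      Measure.pi fun _ => (volume : Measure ℝ).restrict (Ioc 0 1) :=
    Measure.restrict_pi_pi _ _
  simp only [h]
  rw [hr, integral_fintype_prod_eq_prod
    (f := fun i (t : ℝ) => cexp (2 * Real.pi * I * ((v i * k : ℤ) : ℂ) * t))]
  exact Finset.prod_eq_zero (Finset.mem_univ i) (integral_exp_two_pi_Ioc (mul_ne_zero hi hk))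

/-- Integrating the Fourier series termwise, each frequency k ≠ 0 contributes a nontrivial character
of the torus since v ≠ 0, so only the term k = 0 survives. -/
theorem integral_cosKernel_cube {m : ℕ} {v : Fin m → ℤ} (hv : v ≠ 0) {x : ℝ} (hx : 0 < x) :
    ∫ t : Fin m → ℝ in cube m,
      ((cosKernel ((∑ i, (v i : ℝ) * t i : ℝ) : UnitAddCircle) x : ℝ) : ℂ) = 1 := by
  set F : ℤ → (Fin m → ℝ) → ℂ := fun k t =>
    cexp (2 * Real.pi * I * ((∑ i, (v i : ℝ) * t i : ℝ) : ℂ) * k) * Real.exp (-Real.pi * k ^ 2 * x)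
    with hF
  have hsum : Summable fun k : ℤ => Real.exp (-Real.pi * k ^ 2 * x) := by
    simpa using (hasSum_int_evenKernel 0 hx).summable
  have hnorm (k : ℤ) (t : Fin m → ℝ) : ‖F k t‖ = Real.exp (-Real.pi * k ^ 2 * x) := by
    rw [hF, norm_mul, norm_real, Real.norm_of_nonneg (Real.exp_pos _).le,
      show 2 * Real.pi * I * ((∑ i, (v i : ℝ) * t i : ℝ) : ℂ) * k =
        ((2 * Real.pi * (∑ i, (v i : ℝ) * t i) * k : ℝ) : ℂ) * I by push_cast; ring,
      norm_exp_ofReal_mul_I, one_mul]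
  have hcont (k : ℤ) : Continuous (F k) := by
    simp only [hF]
    fun_prop
  have hint (k : ℤ) : Integrable (F k) (volume.restrict (cube m)) :=
    Integrable.of_bound (hcont k).aestronglyMeasurable _
      (Eventually.of_forall fun t => (hnorm k t).le)
  have h := hasSum_integral_of_summable_integral_norm hint (by simpa [hnorm] using hsum)
  have hval (k : ℤ) : ∫ t in cube m, F k t = if k = 0 then 1 else 0 := by
    split_ifs with hk
    · subst hk
      have : F 0 = fun _ => 1 := by ext t; simp [hF]
      rw [this]
      simp
    · simp only [hF, integral_mul_const]
      rw [integral_exp_cube hv hk, zero_mul]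
  simp only [hval] at h
  rw [← h.unique (hasSum_ite_eq 0 1)]
  refine integral_congr_ae (Eventually.of_forall fun t => ?_)
  exact (hasSum_int_cosKernel (∑ i, (v i : ℝ) * t i) hx).tsum_eq.symm

theorem integral_evenKernel_cube {m : ℕ} {v : Fin m → ℤ} (hv : v ≠ 0) {x : ℝ} (hx : 0 < x) :
    ∫ t : Fin m → ℝ in cube m,
      evenKernel ((∑ i, (v i : ℝ) * t i : ℝ) : UnitAddCircle) x = x ^ (-(1 / 2) : ℝ) := by
  simp only [evenKernel_eq_rpow_mul_cosKernel _ hx]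
  have h := integral_cosKernel_cube hv (one_div_pos.2 hx)
  rw [integral_complex_ofReal] at h
  rw [integral_const_mul, ofReal_eq_one.1 h, mul_one]

/-- A family of triangular matrices in which only the last column varies, and takes the values
`(t, 1)`. -/
structure IsColumnFamily {m : ℕ} (A : Matrix (Fin m) (Fin m) ℝ)
    (G : (Fin m → ℝ) → Matrix (Fin (m + 1)) (Fin (m + 1)) ℝ) : Prop where
  isPosTriangular : ∀ t, IsPosTriangular (G t)
  topBlock_eq : ∀ t, topBlock (G t) = A
  apply_castSucc_last : ∀ t i, G t i.castSucc (Fin.last m) = t i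
  apply_last_last : ∀ t, G t (Fin.last m) (Fin.last m) = 1
  continuous_apply : ∀ i j, Continuous fun t => G t i j

namespace IsColumnFamily

variable {m : ℕ} {A : Matrix (Fin m) (Fin m) ℝ}
  {G : (Fin m → ℝ) → Matrix (Fin (m + 1)) (Fin (m + 1)) ℝ}

theorem block (hG : IsColumnFamily A G) : IsPosTriangular A :=
  hG.topBlock_eq 0 ▸ (hG.isPosTriangular 0).topBlock

theorem det_eq (hG : IsColumnFamily A G) (t : Fin m → ℝ) : (G t).det = A.det := by
  rw [(hG.isPosTriangular t).det_eq_mul, hG.topBlock_eq, hG.apply_last_last, mul_one]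

theorem lastShift_eq (hG : IsColumnFamily A G) (t : Fin m → ℝ) (v : Fin m → ℤ) :
    lastShift (G t) v = ∑ i, (v i : ℝ) * t i := by
  simp [lastShift, hG.apply_castSucc_last, hG.apply_last_last]

theorem hasSum_theta (hG : IsColumnFamily A G) (t : Fin m → ℝ) {x : ℝ} (hx : 0 < x) :
    HasSum (fun v : Fin m → ℤ => Real.exp (-Real.pi * rowQ A v * x) *
      evenKernel ((∑ i, (v i : ℝ) * t i : ℝ) : UnitAddCircle) x) (theta (G t) x) := by
  have h := (hG.isPosTriangular t).hasSum_theta_succ hx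
  simpa only [hG.topBlock_eq, hG.lastShift_eq, hG.apply_last_last, one_pow, one_mul] using h

theorem theta_zero (hG : IsColumnFamily A G) {x : ℝ} (hx : 0 < x) :
    theta (G 0) x = theta A x * evenKernel 0 x := by
  refine (hG.hasSum_theta 0 hx).unique ?_
  simpa using (hG.block.hasSum_theta hx).mul_right (evenKernel 0 x)

theorem theta_le (hG : IsColumnFamily A G) (t : Fin m → ℝ) {x : ℝ} (hx : 0 < x) :
    theta (G t) x ≤ theta (G 0) x := by
  have h := (hG.isPosTriangular t).theta_le hx
  rwa [hG.topBlock_eq, hG.apply_last_last, one_pow, one_mul, ← hG.theta_zero hx] at h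

theorem abs_theta_sub_le (hG : IsColumnFamily A G) (t : Fin m → ℝ) {x : ℝ} (hx : 0 < x) :
    |theta (G t) x - theta A x * x ^ (-(1 / 2) : ℝ)| ≤
      theta (G 0) x - theta A x * x ^ (-(1 / 2) : ℝ) := by
  have h := (hG.isPosTriangular t).abs_theta_sub_le hx
  rwa [hG.topBlock_eq, hG.apply_last_last, one_pow, one_mul, ← hG.theta_zero hx] at h

/-- The mean over the column keeps the full one-dimensional kernel for v = 0, the source of the term
2 det^s, and only its zeroth Fourier coefficient x^(-1/2) for the other v. -/
theorem integral_theta (hG : IsColumnFamily A G) {x : ℝ} (hx : 0 < x) :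
    ∫ t in cube m, theta (G t) x =
      evenKernel 0 x + x ^ (-(1 / 2) : ℝ) * (theta A x - 1) := by
  set F : (Fin m → ℤ) → (Fin m → ℝ) → ℝ := fun v t => Real.exp (-Real.pi * rowQ A v * x) *
      evenKernel ((∑ i, (v i : ℝ) * t i : ℝ) : UnitAddCircle) x with hF
  have hcont (v : Fin m → ℤ) : Continuous (F v) :=
    continuous_const.mul ((continuous_evenKernel hx).comp (by fun_prop))
  have hnorm (v : Fin m → ℤ) (t : Fin m → ℝ) :
      ‖F v t‖ ≤ Real.exp (-Real.pi * rowQ A v * x) * evenKernel 0 x := by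
    have h0 := evenKernel_nonneg ((∑ i, (v i : ℝ) * t i : ℝ) : UnitAddCircle) hx
    rw [hF, norm_mul, Real.norm_of_nonneg (Real.exp_pos _).le, Real.norm_of_nonneg h0]
    gcongr
    exact evenKernel_le_evenKernel_zero _ hx
  have hint (v : Fin m → ℤ) : Integrable (F v) (volume.restrict (cube m)) :=
    Integrable.of_bound (hcont v).aestronglyMeasurable _ (Eventually.of_forall fun t => hnorm v t)
  have hs : Summable fun v => ∫ t in cube m, ‖F v t‖ := by
    refine Summable.of_nonneg_of_le (fun v => integral_nonneg fun _ => norm_nonneg _) (fun v => ?_)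
      ((hG.block.summable_exp hx).mul_right (evenKernel 0 x))
    refine (integral_mono (hint v).norm (integrable_const _) (hnorm v)).trans ?_
    simp
  have h := hasSum_integral_of_summable_integral_norm hint hs
  have hval (v : Fin m → ℤ) : ∫ t in cube m, F v t =
      Real.exp (-Real.pi * rowQ A v * x) * x ^ (-(1 / 2) : ℝ) +
        if v = 0 then evenKernel 0 x - x ^ (-(1 / 2) : ℝ) else 0 := by
    simp only [hF, integral_const_mul]
    split_ifs with hv
    · subst hv
      simp [rowQ_zero]
    · rw [integral_evenKernel_cube hv hx, add_zero]
  simp only [hval] at h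
  have h2 := ((hG.block.hasSum_theta hx).mul_right (x ^ (-(1 / 2) : ℝ))).add
    (hasSum_ite_eq 0 (evenKernel 0 x - x ^ (-(1 / 2) : ℝ)))
  have h3 : ∫ t in cube m, ∑' v, F v t = ∫ t in cube m, theta (G t) x :=
    integral_congr_ae (Eventually.of_forall fun t => (hG.hasSum_theta t hx).tsum_eq)
  rw [← h3, h.unique h2]
  ring

end IsColumnFamily

/-! ### The constant term of the completed Epstein zeta function -/

/-- The theta kernel `f` with its constant terms at `∞` and at `0` removed. -/
def modif (f : ℝ → ℝ) (k c : ℝ) (x : ℝ) : ℝ :=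
  if 1 < x then f x - 1 else if x < 1 then f x - c * x ^ (-k) else 0

/-- A common formula for the lattice kernels and for the kernel of ξ, so that they can be compared
pointwise under the Mellin integral. -/
theorem WeakFEPair.f_modif_eq_modif (P : WeakFEPair ℂ) {f : ℝ → ℝ} {c : ℝ}
    (hf : ∀ x, P.f x = f x) (h0 : P.f₀ = 1) (hε : P.ε = 1) (hg₀ : P.g₀ = c) {x : ℝ}
    (hx : 0 < x) : P.f_modif x = modif f P.k c x := by
  rcases lt_trichotomy x 1 with h | h | h
  · have h1 : x ∉ Ioi (1 : ℝ) := h.not_gt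
    have h2 : x ∈ Ioo (0 : ℝ) 1 := ⟨hx, h⟩
    simp only [WeakFEPair.f_modif, Pi.add_apply, indicator_of_notMem h1, indicator_of_mem h2, hf,
      hε, hg₀, modif, if_neg h.not_gt, if_pos h]
    push_cast
    rw [smul_eq_mul]
    ring
  · subst h
    simp [WeakFEPair.f_modif, modif]
  · have h1 : x ∈ Ioi (1 : ℝ) := h
    have h2 : x ∉ Ioo (0 : ℝ) 1 := fun h3 => h.not_gt h3.2
    simp only [WeakFEPair.f_modif, Pi.add_apply, indicator_of_mem h1, indicator_of_notMem h2, hf,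
      h0, modif, if_pos h]
    push_cast
    ring

theorem IsThetaKernel.f_modif_eq {f : ℝ → ℝ} {k c : ℝ} (hf : IsThetaKernel f k c) (hk : 0 < k)
    {x : ℝ} (hx : 0 < x) : (hf.pair hk).f_modif x = modif f k c x :=
  WeakFEPair.f_modif_eq_modif _ (fun _ => rfl) rfl rfl rfl hx

theorem hurwitzEvenFEPair_zero_f_modif {x : ℝ} (hx : 0 < x) :
    (hurwitzEvenFEPair 0).f_modif x = modif (evenKernel 0) (1 / 2) 1 x :=
  WeakFEPair.f_modif_eq_modif _ (fun _ => rfl) (if_pos rfl) rfl (by simp [hurwitzEvenFEPair]) hx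

theorem WeakFEPair.hasMellin_f_modif (P : WeakFEPair ℂ) (u : ℂ) :
    HasMellin P.f_modif u (P.Λ₀ u) :=
  ⟨(P.isStrongFEPair_toStrongFEPair.hasMellin u).1, rfl⟩

/-- Joint measurability is needed for Fubini. The sum is taken in `ENNReal`, where countable sums of
measurable functions are measurable without any convergence condition. -/
theorem measurable_theta {m : ℕ} {G : (Fin m → ℝ) → Matrix (Fin (m + 1)) (Fin (m + 1)) ℝ}
    (hG : ∀ i j, Continuous fun t => G t i j) :
    Measurable fun p : (Fin m → ℝ) × ℝ => theta (G p.1) p.2 := by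
  have h (p : (Fin m → ℝ) × ℝ) : theta (G p.1) p.2 =
      (∑' v, ENNReal.ofReal (Real.exp (-Real.pi * rowQ (G p.1) v * p.2))).toReal := by
    rw [ENNReal.tsum_toReal_eq fun _ => ENNReal.ofReal_ne_top, theta]
    exact tsum_congr fun v => (ENNReal.toReal_ofReal (Real.exp_pos _).le).symm
  simp only [h]
  refine (Measurable.tsum fun v => ?_).ennreal_toReal
  refine ENNReal.measurable_ofReal.comp (Continuous.measurable ?_)
  simp only [rowQ, Matrix.vecMul, dotProduct]
  have h2 (i j) : Continuous fun p : (Fin m → ℝ) × ℝ => G p.1 i j := (hG i j).comp continuous_fst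
  fun_prop

namespace IsColumnFamily

variable {m : ℕ} {A : Matrix (Fin m) (Fin m) ℝ}
  {G : (Fin m → ℝ) → Matrix (Fin (m + 1)) (Fin (m + 1)) ℝ}

theorem rpow_split {x : ℝ} (hx : 0 < x) :
    x ^ (-(((m + 1 : ℕ) : ℝ) / 2)) = x ^ (-(1 / 2) : ℝ) * x ^ (-((m : ℝ) / 2)) := by
  rw [← Real.rpow_add hx]
  congr 1
  push_cast
  ring

theorem integrable_theta (hG : IsColumnFamily A G) {x : ℝ} (hx : 0 < x) :
    IntegrableOn (fun t => theta (G t) x) (cube m) := by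
  refine Integrable.of_bound
    ((measurable_theta hG.continuous_apply).comp (by fun_prop :
      Measurable fun t : Fin m → ℝ => (t, x))).aestronglyMeasurable (theta (G 0) x)
    (Eventually.of_forall fun t => ?_)
  have := (hG.isPosTriangular t).one_le_theta hx
  change ‖theta (G t) x‖ ≤ _
  rw [Real.norm_of_nonneg (by linarith)]
  exact hG.theta_le t hx

/-- The subtracted terms match on both sides of 1: for x < 1 the leftover -x^(-1/2) from v = 0 is
exactly the main part removed from the one-dimensional kernel. -/
theorem integral_modif (hG : IsColumnFamily A G) {x : ℝ} (hx : 0 < x) :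
    ∫ t in cube m, modif (theta (G t)) (((m + 1 : ℕ) : ℝ) / 2) A.det⁻¹ x =
      modif (evenKernel 0) (1 / 2) 1 x +
        x ^ (-(1 / 2) : ℝ) * modif (theta A) ((m : ℝ) / 2) A.det⁻¹ x := by
  simp only [modif]
  split_ifs with h1 h2
  · rw [integral_sub (hG.integrable_theta hx) (integrable_const _), hG.integral_theta hx]
    simp
    ring
  · rw [integral_sub (hG.integrable_theta hx) (integrable_const _), hG.integral_theta hx,
      rpow_split hx]
    simp
    ring
  · simp

/-- A majorant independent of `t`, for Fubini. For x < 1 the comparison passes through θ_A(x)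
x^(-1/2), whose distance to the subtracted main part is paid for twice, hence the factor 2. -/
theorem abs_modif_le (hG : IsColumnFamily A G) (t : Fin m → ℝ) {x : ℝ} (hx : 0 < x) :
    |modif (theta (G t)) (((m + 1 : ℕ) : ℝ) / 2) A.det⁻¹ x| ≤
      |modif (theta (G 0)) (((m + 1 : ℕ) : ℝ) / 2) A.det⁻¹ x| +
        2 * |x ^ (-(1 / 2) : ℝ) * modif (theta A) ((m : ℝ) / 2) A.det⁻¹ x| := by
  simp only [modif]
  split_ifs with h1 h2
  · have ht := (hG.isPosTriangular t).one_le_theta hx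
    have h0 := hG.theta_le t hx
    rw [abs_of_nonneg (by linarith), abs_of_nonneg (by linarith)]
    have := abs_nonneg (x ^ (-(1 / 2) : ℝ) * (theta A x - 1))
    linarith
  · have h3 := hG.abs_theta_sub_le t hx
    rw [rpow_split hx]
    set a := theta A x * x ^ (-(1 / 2) : ℝ) with ha
    set b := A.det⁻¹ * (x ^ (-(1 / 2) : ℝ) * x ^ (-((m : ℝ) / 2))) with hb
    have e : x ^ (-(1 / 2) : ℝ) * (theta A x - A.det⁻¹ * x ^ (-((m : ℝ) / 2))) = a - b := by
      rw [ha, hb]; ring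
    rw [e]
    have h4 := abs_add_le (theta (G t) x - a) (a - b)
    have h5 : theta (G 0) x - a ≤ |theta (G 0) x - b| + |a - b| := by
      have h6 := le_abs_self (theta (G 0) x - b)
      have h7 := neg_abs_le (a - b)
      linarith
    rw [sub_add_sub_cancel] at h4
    linarith
  · simp

theorem measurable_modif (hG : IsColumnFamily A G) (k c : ℝ) :
    Measurable fun p : (Fin m → ℝ) × ℝ => modif (theta (G p.1)) k c p.2 := by
  have h := measurable_theta hG.continuous_apply
  refine Measurable.ite (measurableSet_lt measurable_const measurable_snd)
    (h.sub measurable_const) (Measurable.ite (measurableSet_lt measurable_snd measurable_const)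
    (h.sub ?_) measurable_const)
  fun_prop

/-- The completed Epstein zeta function of `G t`, without its poles, as an integral. -/
theorem Λ₀_eq_integral (hG : IsColumnFamily A G) (t : Fin m → ℝ) (u : ℂ) :
    ((hG.isPosTriangular t).pair m.succ_pos).Λ₀ u = ∫ x in Ioi (0 : ℝ),
      (x : ℂ) ^ (u - 1) * modif (theta (G t)) (((m + 1 : ℕ) : ℝ) / 2) A.det⁻¹ x := by
  refine setIntegral_congr_fun measurableSet_Ioi fun x hx => ?_
  simp only [smul_eq_mul]
  rw [IsPosTriangular.pair, IsThetaKernel.f_modif_eq _ _ hx, hG.det_eq]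

theorem integrable_modif (hG : IsColumnFamily A G) (hm : 0 < m) (u : ℂ) :
    Integrable (fun p : (Fin m → ℝ) × ℝ => (p.2 : ℂ) ^ (u - 1) *
      modif (theta (G p.1)) (((m + 1 : ℕ) : ℝ) / 2) A.det⁻¹ p.2)
      ((volume.restrict (cube m)).prod (volume.restrict (Ioi (0 : ℝ)))) := by
  have h0 := (WeakFEPair.hasMellin_f_modif ((hG.isPosTriangular 0).pair m.succ_pos) u).1
  have h1 := (WeakFEPair.hasMellin_f_modif (hG.block.pair hm) (u - 1 / 2)).1
  have hB : IntegrableOn (fun x : ℝ => ‖(x : ℂ) ^ (u - 1) •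
      ((hG.isPosTriangular 0).pair m.succ_pos).f_modif x‖ + 2 * ‖(x : ℂ) ^ (u - 1 / 2 - 1) •
      (hG.block.pair hm).f_modif x‖) (Ioi 0) := h0.norm.add (h1.norm.const_mul 2)
  refine (hB.comp_snd (volume.restrict (cube m))).mono' ?_ ?_
  · refine Measurable.aestronglyMeasurable ?_
    have := measurable_modif hG (((m + 1 : ℕ) : ℝ) / 2) A.det⁻¹
    fun_prop
  · have hae : ∀ᵐ p : (Fin m → ℝ) × ℝ ∂((volume.restrict (cube m)).prod
        (volume.restrict (Ioi (0 : ℝ)))), p.2 ∈ Ioi (0 : ℝ) :=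
      Measure.quasiMeasurePreserving_snd.ae (ae_restrict_mem measurableSet_Ioi)
    filter_upwards [hae] with p hp
    obtain ⟨t, x⟩ := p
    have hx : 0 < x := hp
    simp only
    rw [IsPosTriangular.pair, IsPosTriangular.pair, IsThetaKernel.f_modif_eq _ _ hx,
      IsThetaKernel.f_modif_eq _ _ hx, hG.det_eq, norm_smul, norm_smul, norm_mul, norm_real,
      norm_real, norm_real, norm_cpow_eq_rpow_re_of_pos hx, norm_cpow_eq_rpow_re_of_pos hx]
    -- The factor x^(-1/2) from the average shifts the Mellin variable of the block to u - 1/2.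
    have hr : x ^ (u - 1 / 2 - 1).re = x ^ (u - 1).re * x ^ (-(1 / 2) : ℝ) := by
      rw [← Real.rpow_add hx]
      congr 1
      simp
      ring
    have h := hG.abs_modif_le t hx
    rw [abs_mul, abs_of_pos (Real.rpow_pos_of_pos hx _)] at h
    rw [hr]
    have hp := Real.rpow_pos_of_pos hx (u - 1).re
    calc _ ≤ x ^ (u - 1).re * _ := mul_le_mul_of_nonneg_left h hp.le
      _ = _ := by simp only [Real.norm_eq_abs]; ring

theorem integrable_Λ₀ (hG : IsColumnFamily A G) (hm : 0 < m) (u : ℂ) :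
    IntegrableOn (fun t => ((hG.isPosTriangular t).pair m.succ_pos).Λ₀ u) (cube m) := by
  simp only [hG.Λ₀_eq_integral]
  exact (hG.integrable_modif hm u).integral_prod_left

theorem integral_Λ₀ (hG : IsColumnFamily A G) (hm : 0 < m) (u : ℂ) :
    ∫ t in cube m, ((hG.isPosTriangular t).pair m.succ_pos).Λ₀ u =
      (hurwitzEvenFEPair 0).Λ₀ u + (hG.block.pair hm).Λ₀ (u - 1 / 2) := by
  simp only [hG.Λ₀_eq_integral]
  rw [integral_integral_swap (hG.integrable_modif hm u)]
  have h0 := (WeakFEPair.hasMellin_f_modif (hurwitzEvenFEPair 0) u).1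
  have h1 := (WeakFEPair.hasMellin_f_modif (hG.block.pair hm) (u - 1 / 2)).1
  refine Eq.trans ?_ (integral_add h0 h1)
  refine setIntegral_congr_fun measurableSet_Ioi fun x hx => ?_
  have hx : 0 < x := hx
  rw [integral_const_mul, integral_complex_ofReal, hG.integral_modif hx,
    hurwitzEvenFEPair_zero_f_modif hx, IsPosTriangular.pair, IsThetaKernel.f_modif_eq _ _ hx,
    smul_eq_mul, smul_eq_mul]
  have hr : (x : ℂ) ^ (u - 1 / 2 - 1) = (x : ℂ) ^ (u - 1) * ((x ^ (-(1 / 2) : ℝ) : ℝ) : ℂ) := by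
    rw [ofReal_cpow hx.le, ← cpow_add _ _ (ofReal_ne_zero.2 hx.ne')]
    congr 1
    push_cast
    ring
  rw [hr]
  push_cast
  ring

end IsColumnFamily

/-! ### The constant term of the Eisenstein series -/

theorem completedRiemannZeta_ne_zero_of_xiEntire {w : ℂ} (h0 : w ≠ 0) (h1 : w ≠ 1)
    (h : xiEntire w ≠ 0) : completedRiemannZeta w ≠ 0 := by
  rw [xiEntire_eq h0 h1] at h
  exact right_ne_zero_of_mul h

theorem eventually_xiEntire_ne_zero {n : ℕ} (hn : 0 < n) (b s : ℂ) :
    ∀ᶠ s' in 𝓝[≠] s, xiEntire (n * s' - b) ≠ 0 := by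
  have hn0 : (n : ℂ) ≠ 0 := Nat.cast_ne_zero.2 hn.ne'
  have hd : Differentiable ℂ fun s' : ℂ => xiEntire (n * s' - b) :=
    differentiable_xiEntire.comp (by fun_prop)
  refine (hd.analyticAt s).eventually_eq_zero_or_eventually_ne_zero.resolve_left fun h => ?_
  have h1 := AnalyticOnNhd.eq_of_eventuallyEq (f := fun s' : ℂ => xiEntire (n * s' - b))
    (g := fun _ => 0) (fun x _ => hd.analyticAt x) (fun x _ => analyticAt_const) h
  -- At b/n the argument is 0, where `xiEntire` equals 1, so the function is not identically zero.
  have h2 := congrFun h1 (b / n)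
  simp [xiEntire, mul_div_cancel₀ b hn0] at h2

theorem eventually_mul_ne {n : ℕ} (hn : 0 < n) (a s : ℂ) : ∀ᶠ s' in 𝓝[≠] s, n * s' ≠ a := by
  have hn0 : (n : ℂ) ≠ 0 := Nat.cast_ne_zero.2 hn.ne'
  by_cases h : s = a / n
  · filter_upwards [self_mem_nhdsWithin] with s' hs' h'
    exact hs' (by rw [mem_singleton_iff, h, ← h', mul_div_cancel_left₀ _ hn0])
  · filter_upwards [(eventually_ne_nhds h).filter_mono nhdsWithin_le_nhds] with s' hs' h'
    exact hs' (by rw [← h', mul_div_cancel_left₀ _ hn0])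

namespace IsColumnFamily

variable {k : ℕ} {A : GL (Fin (k + 1)) ℝ} {G : (Fin (k + 1) → ℝ) → GL (Fin (k + 1 + 1)) ℝ}

/-- The entire part of the averaged completed Epstein zeta function. -/
def meanΛ₀ (hG : IsColumnFamily (A : Matrix (Fin (k + 1)) (Fin (k + 1)) ℝ) fun t => (G t).1)
    (u : ℂ) : ℂ :=
  (hurwitzEvenFEPair 0).Λ₀ u + (hG.block.pair k.succ_pos).Λ₀ (u - 1 / 2)

theorem differentiable_meanΛ₀
    (hG : IsColumnFamily (A : Matrix (Fin (k + 1)) (Fin (k + 1)) ℝ) fun t => (G t).1) :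
    Differentiable ℂ hG.meanΛ₀ :=
  (hurwitzEvenFEPair 0).differentiable_Λ₀.add
    ((hG.block.pair k.succ_pos).differentiable_Λ₀.comp (by fun_prop))

theorem eisenstein_eq
    (hG : IsColumnFamily (A : Matrix (Fin (k + 1)) (Fin (k + 1)) ℝ) fun t => (G t).1) {s : ℂ}
    (hs : s ≠ 1) (hs' : xiEntire ((k + 1 + 1 : ℕ) * s) ≠ 0) (t : Fin (k + 1) → ℝ) :
    eisenstein (QuotientGroup.mk (G t) : UpperHalf (k + 1 + 1)) s =
      eisensteinCont (k + 1 + 1) A.1.det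
        ((hG.isPosTriangular t).pair (k + 1).succ_pos).Λ₀ s := by
  rw [(eisenstein_mk_eventuallyEq k.succ_pos (G t) (hG.isPosTriangular t) hs hs').eq_of_nhds,
    hG.det_eq t]

/-- In a column family the determinant is constant and only `L` varies, so this affine dependence
lets averaging pass to the entire parts. -/
theorem eisensteinCont_eq_affine (n : ℕ) (D : ℝ) (L : ℂ → ℂ) (s : ℂ) :
    eisensteinCont n D L s =
      (D : ℂ) ^ s * (n * s * (n * s - 1)) / xiEntire (n * s) * L (n * s / 2) +
        eisensteinCont n D 0 s := by
  simp only [eisensteinCont, eisensteinNum, Pi.zero_apply]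
  ring

theorem integrableOn_eisenstein
    (hG : IsColumnFamily (A : Matrix (Fin (k + 1)) (Fin (k + 1)) ℝ) fun t => (G t).1) {s : ℂ}
    (hs : s ≠ 1) (hs' : xiEntire ((k + 1 + 1 : ℕ) * s) ≠ 0) :
    IntegrableOn (fun t => eisenstein (QuotientGroup.mk (G t) : UpperHalf (k + 1 + 1)) s)
      (cube (k + 1)) := by
  simp only [hG.eisenstein_eq hs hs', eisensteinCont_eq_affine _ _ (WeakFEPair.Λ₀ _)]
  exact ((hG.integrable_Λ₀ k.succ_pos _).const_mul _).add (integrable_const _)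

theorem integral_eisenstein
    (hG : IsColumnFamily (A : Matrix (Fin (k + 1)) (Fin (k + 1)) ℝ) fun t => (G t).1) {s : ℂ}
    (hs : s ≠ 1) (hs' : xiEntire ((k + 1 + 1 : ℕ) * s) ≠ 0) :
    ∫ t in cube (k + 1), eisenstein (QuotientGroup.mk (G t) : UpperHalf (k + 1 + 1)) s =
      eisensteinCont (k + 1 + 1) A.1.det hG.meanΛ₀ s := by
  simp only [hG.eisenstein_eq hs hs', eisensteinCont_eq_affine _ _ (WeakFEPair.Λ₀ _)]
  rw [integral_add ((hG.integrable_Λ₀ k.succ_pos _).const_mul _) (integrable_const _),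
    integral_const_mul, hG.integral_Λ₀ k.succ_pos, eisensteinCont_eq_affine _ _ hG.meanΛ₀]
  simp [meanΛ₀]

/-- The polar terms removed from the two entire parts are restored. With w = ns, the pole of 2ξ(w)
at w = 1 cancels that of Λ_A((w-1)/2), and the rest are the terms built into `eisensteinNum`; what
remains is 2ξ(w) + Λ_A((w-1)/2). -/
theorem eisensteinCont_meanΛ₀_eq
    (hG : IsColumnFamily (A : Matrix (Fin (k + 1)) (Fin (k + 1)) ℝ) fun t => (G t).1) (hk : 0 < k)
    {s : ℂ} (hs : s ≠ 1) (hs' : xiEntire ((k + 1 + 1 : ℕ) * s) ≠ 0)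
    (h0 : (k + 1 + 1 : ℕ) * s ≠ 0) (h1 : (k + 1 + 1 : ℕ) * s ≠ 1)
    (h2 : (k + 1 + 1 : ℕ) * s ≠ 2)
    (h3 : completedRiemannZeta ((k + 1 + 1 : ℕ) * s - 1) ≠ 0) :
    eisensteinCont (k + 1 + 1) A.1.det hG.meanΛ₀ s =
      2 * (A.1.det : ℂ) ^ s + completedRiemannZeta ((k + 1 + 1 : ℕ) * s - 1) /
        completedRiemannZeta ((k + 1 + 1 : ℕ) * s) *
          (A.1.det : ℂ) ^ ((1 - s) / (((k + 1 + 1 : ℕ) : ℂ) - 1)) *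
          eisenstein (QuotientGroup.mk A : UpperHalf (k + 1))
            (((k + 1 + 1 : ℕ) * s - 1) / (((k + 1 + 1 : ℕ) : ℂ) - 1)) := by
  have hD : (A.1.det : ℂ) ≠ 0 := ofReal_ne_zero.2 hG.block.det_pos.ne'
  have hk0 : ((k + 1 : ℕ) : ℂ) ≠ 0 := Nat.cast_ne_zero.2 k.succ_ne_zero
  have hn0 : ((k + 1 + 1 : ℕ) : ℂ) ≠ 0 := Nat.cast_ne_zero.2 (k + 1).succ_ne_zero
  have hnk : ((k + 1 + 1 : ℕ) : ℂ) - 1 = ((k + 1 : ℕ) : ℂ) := by push_cast; ring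
  rw [hnk]
  have hnk' : ((k + 1 : ℕ) : ℂ) = ((k + 1 + 1 : ℕ) : ℂ) - 1 := hnk.symm
  set n : ℂ := ((k + 1 + 1 : ℕ) : ℂ) with hn
  set w : ℂ := n * s with hw
  set s' : ℂ := (w - 1) / ((k + 1 : ℕ) : ℂ) with hs'def
  have hmul : ((k + 1 : ℕ) : ℂ) * s' = w - 1 := mul_div_cancel₀ _ hk0
  have hs1 : 1 - s ≠ 0 := sub_ne_zero.2 hs.symm
  have hw1 : w - 1 ≠ 0 := sub_ne_zero.2 h1
  have hw1' : 1 - w ≠ 0 := sub_ne_zero.2 h1.symm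
  have hs'1 : s' ≠ 1 := by
    intro h
    rw [h, mul_one, hnk', sub_left_inj, hw] at hmul
    exact hs (mul_left_cancel₀ hn0 (by rw [mul_one]; exact hmul.symm))
  have hA : eisenstein (QuotientGroup.mk A : UpperHalf (k + 1)) s' = (A.1.det : ℂ) ^ s' *
      ((hG.block.pair k.succ_pos).Λ ((w - 1) / 2) / completedRiemannZeta (w - 1)) := by
    have hx : xiEntire ((k + 1 : ℕ) * s') ≠ 0 := by
      rw [hmul]
      exact xiEntire_ne_zero (Or.inr (Or.inr h3))
    rw [(eisenstein_mk_eventuallyEq hk A hG.block hs'1 hx).eq_of_nhds,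
      hG.block.eisensteinCont_eq k.succ_pos hs'1 (by rwa [hmul])
        (by rw [hmul]; intro h; exact h2 (by linear_combination h)), hmul]
  -- Since s = (1-s)/(n-1) + s', this accounts for the exponent (1-s)/(n-1) in the formula.
  have hpow : (A.1.det : ℂ) ^ s =
      (A.1.det : ℂ) ^ ((1 - s) / ((k + 1 : ℕ) : ℂ)) * (A.1.det : ℂ) ^ s' := by
    rw [← cpow_add _ _ hD]
    congr 1
    rw [hs'def, ← add_div, eq_div_iff hk0, hnk', hw]
    ring
  have hxi := completedRiemannZeta_ne_zero_of_xiEntire h0 h1 hs'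
  have hK : (hurwitzEvenFEPair 0).Λ₀ (w / 2) =
      2 * (completedRiemannZeta w + 1 / w + 1 / (1 - w)) := by
    have e : completedRiemannZeta₀ w = (hurwitzEvenFEPair 0).Λ₀ (w / 2) / 2 := rfl
    have := completedRiemannZeta_eq w
    rw [e] at this
    rw [this]
    ring
  have hΛ : (hG.block.pair k.succ_pos).Λ₀ ((w - 1) / 2) =
      (hG.block.pair k.succ_pos).Λ ((w - 1) / 2) + 2 / (w - 1) +
        2 * (A.1.det : ℂ)⁻¹ / (n * (1 - s)) := by
    have e : (hG.block.pair k.succ_pos).Λ ((w - 1) / 2) =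
        (hG.block.pair k.succ_pos).Λ₀ ((w - 1) / 2) - (1 / ((w - 1) / 2)) * 1 -
          (1 / (((((k + 1 : ℕ) : ℝ) / 2 : ℝ) : ℂ) - (w - 1) / 2)) * ((A.1.det⁻¹ : ℝ) : ℂ) := rfl
    have e2 : ((((k + 1 : ℕ) : ℝ) / 2 : ℝ) : ℂ) - (w - 1) / 2 = n * (1 - s) / 2 := by
      rw [ofReal_div, ofReal_natCast, hnk', hw]
      push_cast
      ring
    rw [e, e2, ofReal_inv]
    field_simp
    ring
  rw [hA, eisensteinCont, eisensteinNum, xiEntire_eq h0 h1, meanΛ₀, ← hn, ← hw,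
    show w / 2 - 1 / 2 = (w - 1) / 2 by ring, hK, hΛ]
  have e1 : completedRiemannZeta (w - 1) / completedRiemannZeta w *
      (A.1.det : ℂ) ^ ((1 - s) / ((k + 1 : ℕ) : ℂ)) * ((A.1.det : ℂ) ^ s' *
      ((hG.block.pair k.succ_pos).Λ ((w - 1) / 2) / completedRiemannZeta (w - 1))) =
      (A.1.det : ℂ) ^ s * (hG.block.pair k.succ_pos).Λ ((w - 1) / 2) / completedRiemannZeta w := by
    rw [hpow]
    field_simp
  rw [e1]
  have e3 : 1 / (1 - w) = -(1 / (w - 1)) := by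
    rw [← neg_sub w 1, div_neg]
  rw [e3]
  field_simp
  ring

end IsColumnFamily

/-! ### Iwasawa forms as a column family -/

theorem yProd_eq_det {m : ℕ} (x : Fin (m + 1) → Fin (m + 1) → ℝ) (y : Fin m → ℝ)
    (hy : ∀ k, 0 < y k) :
    yProd (n := m + 1) y =
      (iwasawa (n := m + 1) x y hy : Matrix (Fin (m + 1)) (Fin (m + 1)) ℝ).det := by
  rw [(isPosTriangular_iwasawa (n := m + 1) x y hy).det_eq]
  simp only [iwasawa_apply_self, diagEntry, Finset.prod_filter]
  -- Each coordinate y_k is then counted by the number of diagonal entries containing it, which is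
  -- its exponent.
  rw [Finset.prod_comm]
  refine Finset.prod_congr rfl fun k _ => ?_
  rw [Fin.prod_univ_eq_prod_range (fun i => if k.val + i + 1 < m + 1 then y k else 1) (m + 1),
    ← Finset.prod_filter, Finset.prod_const]
  congr 1
  have : Finset.filter (fun i => k.val + i + 1 < m + 1) (Finset.range (m + 1)) =
      Finset.range (m - k.val) := by
    ext i
    simp only [Finset.mem_filter, Finset.mem_range]
    omega
  rw [this, Finset.card_range]
  rfl

theorem isColumnFamily_iwasawa {m : ℕ} (x : Fin (m + 1) → Fin (m + 1) → ℝ) (y : Fin m → ℝ)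
    (hy : ∀ k, 0 < y k) :
    IsColumnFamily (m := m) (leviBlock (iwasawa (n := m + 1) x y hy)
      (isParabolic_iwasawa (n := m + 1) x y hy)).1
      fun t => (iwasawa (n := m + 1) (setLastCol (n := m + 1) x t) y hy).1 where
  isPosTriangular t := isPosTriangular_iwasawa (n := m + 1) _ y hy
  topBlock_eq t := by
    ext i j
    change (unip (setLastCol (n := m + 1) x t) * Matrix.diagonal (diagEntry (n := m + 1) y))
      i.castSucc j.castSucc = (unip x * Matrix.diagonal (diagEntry (n := m + 1) y))
      i.castSucc j.castSucc
    have : j.val ≠ m := j.isLt.ne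
    simp [Matrix.mul_diagonal, unip, setLastCol, this]
  apply_castSucc_last t i := by
    change (unip (setLastCol (n := m + 1) x t) * Matrix.diagonal (diagEntry (n := m + 1) y))
      i.castSucc (Fin.last m) = _
    rw [Matrix.mul_diagonal, diagEntry_last]
    simp [unip, setLastCol, (Fin.castSucc_lt_last i).ne]
  apply_last_last t := by
    rw [iwasawa_apply_self, diagEntry_last]
  continuous_apply i j := by
    change Continuous fun t : Fin m → ℝ => (unip (setLastCol (n := m + 1) x t) *
      Matrix.diagonal (diagEntry (n := m + 1) y)) i j
    simp only [Matrix.mul_diagonal, unip, setLastCol, Matrix.of_apply]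
    refine Continuous.mul ?_ continuous_const
    split_ifs
    · exact continuous_const
    · exact continuous_apply _
    · exact continuous_const
    · exact continuous_const

end DegenerateEisenstein
end

open DegenerateEisenstein in
theorem proposition3p4 (n : ℕ) (hn : 3 ≤ n) (x : Fin n → Fin n → ℝ) (y : Fin (n - 1) → ℝ)
    (hy : ∀ k, 0 < y k) :
    (∀ z : UpperHalf n, IsEisenstein z (eisenstein z)) ∧
    (∀ w : UpperHalf (n - 1), IsEisenstein w (eisenstein w)) ∧
    ∀ s : ℂ, s ≠ 1 → (n * s = 0 ∨ n * s = 1 ∨ completedRiemannZeta (n * s) ≠ 0) →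
      (∀ z : UpperHalf n, AnalyticAt ℂ (eisenstein z) s) ∧
      IntegrableOn (fun t : Fin (n - 1) → ℝ =>
        eisenstein (QuotientGroup.mk (iwasawa (setLastCol x t) y hy) : UpperHalf n) s)
        (unitCube n) ∧
      Tendsto (constantTerm y (QuotientGroup.mk
          (leviBlock (iwasawa x y hy) (isParabolic_iwasawa x y hy)) : UpperHalf (n - 1)))
        (𝓝[≠] s)
        (𝓝 (∫ t in unitCube n,
          eisenstein (QuotientGroup.mk (iwasawa (setLastCol x t) y hy) : UpperHalf n) s)) ∧
      (n * s ≠ 0 → n * s ≠ 1 → n * s ≠ 2 → completedRiemannZeta (n * s - 1) ≠ 0 →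
        ∫ t in unitCube n,
          eisenstein (QuotientGroup.mk (iwasawa (setLastCol x t) y hy) : UpperHalf n) s =
        2 * (yProd y : ℂ) ^ s +
          completedRiemannZeta (n * s - 1) / completedRiemannZeta (n * s) *
            (yProd y : ℂ) ^ ((1 - s) / ((n : ℂ) - 1)) *
            eisenstein (QuotientGroup.mk
              (leviBlock (iwasawa x y hy) (isParabolic_iwasawa x y hy)) : UpperHalf (n - 1))
              ((n * s - 1) / ((n : ℂ) - 1))) := by
  obtain ⟨k, rfl⟩ : ∃ k, n = k + 1 + 1 := ⟨n - 2, by omega⟩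
  have hk : 0 < k := by omega
  have hG := isColumnFamily_iwasawa (m := k + 1) x y hy
  have hD : yProd y = (leviBlock (iwasawa x y hy) (isParabolic_iwasawa x y hy)).1.det := by
    -- The column 0 is an arbitrary choice: the determinant does not depend on it and equals that of
    -- the block, the corner entry being 1.
    have h := yProd_eq_det (m := k + 1) (setLastCol (n := k + 1 + 1) x 0) y hy
    rw [h]
    exact hG.det_eq 0
  have hn0 : 0 < k + 1 + 1 := (k + 1).succ_pos
  refine ⟨fun z => isEisenstein_eisenstein k.succ_pos z, fun w => isEisenstein_eisenstein hk w,
    fun s hs hs' => ?_⟩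
  have hxi := xiEntire_ne_zero hs'
  refine ⟨fun z => ?_, hG.integrableOn_eisenstein hs hxi, ?_, fun h0 h1 h2 h3 => ?_⟩
  · obtain ⟨g, hg, rfl⟩ := exists_isPosTriangular_mk z
    exact (analyticAt_eisensteinCont hn0 hg.det_pos (hg.pair hn0).differentiable_Λ₀ hs hxi).congr
      (eisenstein_mk_eventuallyEq k.succ_pos g hg hs hxi).symm
  · have hI := hG.integral_eisenstein hs hxi
    have hc := ((analyticAt_eisensteinCont hn0 hG.block.det_pos hG.differentiable_meanΛ₀ hs
      hxi).continuousAt.continuousWithinAt (s := {s}ᶜ)).tendsto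
    rw [← hI] at hc
    refine Tendsto.congr' ?_ hc
    -- The values excluded in the explicit formula are isolated, so it holds on a punctured
    -- neighbourhood of `s`; the averaged continuation is analytic at `s` and supplies the limit.
    -- The condition n s' ≠ n says s' ≠ 1.
    filter_upwards [eventually_mul_ne hn0 0 s, eventually_mul_ne hn0 1 s,
      eventually_mul_ne hn0 2 s, eventually_mul_ne hn0 ((k + 1 + 1 : ℕ) : ℂ) s,
      eventually_xiEntire_ne_zero hn0 0 s, eventually_xiEntire_ne_zero hn0 1 s]
      with s' h0 h1 h2 h3 h4 h5
    have h6 : s' ≠ 1 := fun h => h3 (by rw [h, mul_one])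
    rw [sub_zero] at h4
    rw [hG.eisensteinCont_meanΛ₀_eq hk h6 h4 h0 h1 h2
      (completedRiemannZeta_ne_zero_of_xiEntire (sub_ne_zero.2 h1)
        (fun h => h2 (by linear_combination h)) h5), constantTerm, hD]
    rfl
  · rw [hD]
    exact (hG.integral_eisenstein hs hxi).trans
      (hG.eisensteinCont_meanΛ₀_eq hk hs hxi h0 h1 h2 h3)
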